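/- Let $n\ge 1$, let $\alpha(0)=0,\alpha(1),\dots,\alpha(n)\in\mathbb Z^n$ be the vertices of an $n$-simplex in $\mathbb R^n$, let $y\in\mathbb Z^n$ lie in the interior of this simplex, and put $A=\{\alpha(0),\dots,\alpha(n),y\}$. For $b=(b_0,\dots,b_n)\in(\mathbb C^*)^{n+1}$ with $b_0=1$ and $c\in\mathbb C^*$ consider the family $$f_\kappa(\mathbf z)=\kappa\, e^{i\arg c}\,\mathbf z^{y}+\sum_{i=0}^n b_i\,\mathbf z^{\alpha(i)},\qquad \kappa\ge 0,\ \mathbf z\in(\mathbb C^*)^n .$$ The amoeba $\mathcal A(f)\subset\mathbb R^n$ is the image of $\{\mathbf z\in(\mathbb C^*)^n: f(\mathbf z)=0\}$ under $\mathbf z\mapsto(\log|z_1|,\dots,\log|z_n|)$. A point $\mathbf w\notin\mathcal A(f)$ has order $\left(\frac1{(2\pi i)^n}\int_{|z_1|=e^{w_1},\dots,|z_n|=e^{w_n}}\frac{z_j\partial_jf(\mathbf z)}{f(\mathbf z)}\frac{dz_1\cdots dz_n}{z_1\cdots z_n}\right)_{1\le j\le n}$, and $E_y(f)$ is the set of points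 of $\mathbb R^n\setminus\mathcal A(f)$ of order $y$. The amoeba $\mathcal A(f_\kappa)$ switches from genus $0$ to genus $1$ at $\kappa_0\ge0$ if $E_y(f_{\kappa_0})=\emptyset$ and $E_y(f_{\kappa_0+\varepsilon})\ne\emptyset$ for all sufficiently small $\varepsilon>0$; it switches the last time at the maximum of all such $\kappa_0$. The argument $\arg c$ is in extreme opposition if there is $\mathbf z\in(\mathbb C^*)^n$ with $\arg(c\,\mathbf z^y)\equiv\arg(b_i\mathbf z^{\alpha(i)})+\pi \pmod{2\pi}$ for all $0\le i\le n$. Let $M$ be the matrix with columns $\alpha(1),\dots,\alpha(n)$, let $\widehat M$ be the matrix with columns $\alpha(1)-y,\dots,\alpha(n)-y$, let $M_j$ and $\widehat M_j$ arise from $M$ and $\widehat M$ by replacing the $j$-th column by $y$, and let $$\widehat\Theta=\prod_{i=1}^n\left(\frac{\det(\widehat M)\, b_i}{\det(\widehat M_i)}\right)^{\det(M_i)/\det(M)}$$ (only $|\widehat\Theta|$ is used, which does not depend on the branches of the powers). Let $\nabla_0\subset(\mathbb C^*)^A$ be the set of coefficient vectors of Laurent polynomials $f$ with support $A$ for which there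 is $\mathbf z^*\in(\mathbb C^*)^n$ with $f(\mathbf z^*)=\partial_1f(\mathbf z^*)=\dots=\partial_nf(\mathbf z^*)=0$, and let $\nabla_A$ be its Zariski closure. If $\nabla_A$ has codimension $1$, the $A$-discriminant $\Delta_A$ is the irreducible polynomial with integer coefficients, in the coefficients of $f$ as variables, that vanishes on $\nabla_A$ (it is unique up to sign). **Claim.** The $A$-discriminant $\Delta_A$ exists (in particular $\nabla_A$ has codimension $1$), it is a binomial, and its zero set among the points of projective space with all coordinates nonzero is exactly the set of points $(1:b_1:\dots:b_n:c)$ with $b_1,\dots,b_n,c\in\mathbb C^*$ such that $\arg c$ is in extreme opposition and $\mathcal A(f_\kappa)$ switches the last time from genus $0$ to genus $1$ exactly at the value $$\kappa=|c|=|\widehat\Theta|\cdot\left(1+\sum_{j=1}^n\frac{\det\widehat M_j}{\det\widehat M}\right).$$ -/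

import Mathlib

open scoped LinearAlgebra.Projectivization

noncomputable section

namespace AmoebaDisc

section Laurent

variable {ι : Type*} [Fintype ι] {n : ℕ}

/-- The Laurent monomial `z ^ a = z₁ ^ a₁ ⋯ zₙ ^ aₙ`. -/
def monom (a : Fin n → ℤ) (z : Fin n → ℂ) : ℂ := ∏ k, z k ^ a k

/-- The value at `z` of the Laurent polynomial with exponents `A i` and coefficients `b i`. -/
def laurent (A : ι → Fin n → ℤ) (b : ι → ℂ) (z : Fin n → ℂ) : ℂ := ∑ i, b i * monom (A i) z

/-- The partial derivative `∂F/∂z_j` at the point `z`. -/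
def partialDeriv (F : (Fin n → ℂ) → ℂ) (j : Fin n) (z : Fin n → ℂ) : ℂ :=
  deriv (fun t => F (Function.update z j t)) (z j)

/-- The amoeba: the image of the zero set in the complex torus under
`z ↦ (log |z₁|, …, log |zₙ|)`. -/
def amoeba (A : ι → Fin n → ℤ) (b : ι → ℂ) : Set (Fin n → ℝ) :=
  {w | ∃ z : Fin n → ℂ, (∀ k, z k ≠ 0) ∧ laurent A b z = 0 ∧ ∀ k, Real.log ‖z k‖ = w k}

/-- The `j`-th component of the order of a point `w` of the amoeba complement,
`(2πi)⁻ⁿ ∫ (z_j ∂_j f(z) / f(z)) dz₁ ⋯ dzₙ / (z₁ ⋯ zₙ)` over the torus `|z_k| = exp w_k`. -/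
def order (A : ι → Fin n → ℤ) (b : ι → ℂ) (w : Fin n → ℝ) (j : Fin n) : ℂ :=
  ((2 * Real.pi * Complex.I : ℂ) ^ n)⁻¹ *
    ∯ z in T((0 : Fin n → ℂ), fun k => Real.exp (w k)),
      z j * partialDeriv (laurent A b) j z / laurent A b z * (∏ k, z k)⁻¹

/-- `E_a(f)`: the points of the complement of the amoeba which have order `a`. -/
def orderComponent (A : ι → Fin n → ℤ) (b : ι → ℂ) (a : Fin n → ℤ) : Set (Fin n → ℝ) :=
  {w | w ∉ amoeba A b ∧ ∀ j, order A b w j = (a j : ℂ)}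

/-- `∇₀`: the Laurent polynomials with all coefficients nonzero which vanish, together with all
their first partial derivatives, at some point of the complex torus. -/
def nablaZero (A : ι → Fin n → ℤ) : Set (ι → ℂ) :=
  {b | (∀ i, b i ≠ 0) ∧ ∃ z : Fin n → ℂ, (∀ k, z k ≠ 0) ∧ laurent A b z = 0 ∧
    ∀ j, partialDeriv (laurent A b) j z = 0}

/-- `∇_A`: the Zariski closure of `∇₀`. -/
def nabla (A : ι → Fin n → ℤ) : Set (ι → ℂ) :=
  MvPolynomial.zeroLocus ℂ (MvPolynomial.vanishingIdeal ℂ (nablaZero A))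

/-- `Δ` is an `A`-discriminant: `∇_A` has codimension one, and `Δ` is an irreducible polynomial
with integer coefficients, in the coefficients of the Laurent polynomial as variables, which
vanishes on `∇_A`. -/
def IsADiscriminant (A : ι → Fin n → ℤ) (Δ : MvPolynomial ι ℤ) : Prop :=
  (MvPolynomial.vanishingIdeal ℂ (nabla A)).height = 1 ∧ Irreducible Δ ∧
    ∀ b ∈ nabla A, MvPolynomial.aeval b Δ = 0

end Laurent

/-- A binomial: exactly two monomials occur with nonzero coefficient. -/
def IsBinomial {ι : Type*} (Δ : MvPolynomial ι ℤ) : Prop := Δ.support.card = 2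

/-- The zero set of `Δ` among the projective points all of whose coordinates are nonzero. -/
def torusVariety {ι : Type*} (Δ : MvPolynomial ι ℤ) : Set (ℙ ℂ (ι → ℂ)) :=
  {p | ∀ (v : ι → ℂ) (hv : v ≠ 0), Projectivization.mk ℂ v hv = p →
    (∀ i, v i ≠ 0) ∧ MvPolynomial.aeval v Δ = 0}

section Simplex

variable {n : ℕ}

/-- The exponents `α(0), …, α(n), y`; the index `none` belongs to `y`. -/
def exponents (α : Fin (n + 1) → Fin n → ℤ) (y : Fin n → ℤ) :
    Option (Fin (n + 1)) → Fin n → ℤ :=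
  fun i => i.elim y α

/-- The coefficient vector `(b₀ : … : bₙ : c)`. -/
def coeffs (b : Fin (n + 1) → ℂ) (c : ℂ) : Option (Fin (n + 1)) → ℂ :=
  fun i => i.elim c b

theorem coeffs_ne_zero {b : Fin (n + 1) → ℂ} (hb : b 0 = 1) (c : ℂ) : coeffs b c ≠ 0 := by
  intro h
  have h1 : b 0 = 0 := congrFun h (some 0)
  simp [hb] at h1

/-- `arg c` is in extreme opposition: at some point `z` of the complex torus, the argument of
`c z ^ y` differs by `π` (modulo `2π`) from that of every `b_i z ^ α(i)`. -/
def ExtremeOpposition (α : Fin (n + 1) → Fin n → ℤ) (y : Fin n → ℤ)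
    (b : Fin (n + 1) → ℂ) (c : ℂ) : Prop :=
  ∃ z : Fin n → ℂ, (∀ k, z k ≠ 0) ∧ ∀ i,
    ((c * monom y z).arg : Real.Angle) =
      ((b i * monom (α i) z).arg : Real.Angle) + (Real.pi : Real.Angle)

/-- The coefficients of `f_κ = κ exp(i arg c) z ^ y + ∑ b_i z ^ α(i)`. -/
def family (b : Fin (n + 1) → ℂ) (c : ℂ) (κ : ℝ) : Option (Fin (n + 1)) → ℂ :=
  coeffs b (κ * Complex.exp (c.arg * Complex.I))

/-- The parameters `κ₀ ≥ 0` at which the amoeba of `f_κ` switches from genus 0 to genus 1: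
`E_y(f_κ₀)` is empty, and `E_y(f_{κ₀ + ε})` is nonempty for all sufficiently small `ε > 0`. -/
def switchSet (α : Fin (n + 1) → Fin n → ℤ) (y : Fin n → ℤ)
    (b : Fin (n + 1) → ℂ) (c : ℂ) : Set ℝ :=
  {κ₀ | 0 ≤ κ₀ ∧ orderComponent (exponents α y) (family b c κ₀) y = ∅ ∧
    ∃ δ > 0, ∀ ε, 0 < ε → ε < δ →
      (orderComponent (exponents α y) (family b c (κ₀ + ε)) y).Nonempty}

/-- The amoeba of `f_κ` switches the last time from genus 0 to genus 1 at `κ`. -/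
def SwitchesLastAt (α : Fin (n + 1) → Fin n → ℤ) (y : Fin n → ℤ)
    (b : Fin (n + 1) → ℂ) (c : ℂ) (κ : ℝ) : Prop :=
  IsGreatest (switchSet α y b c) κ

/-- `M`: the matrix with columns `α(1), …, α(n)`. -/
def matM (α : Fin (n + 1) → Fin n → ℤ) : Matrix (Fin n) (Fin n) ℝ :=
  Matrix.of fun i j => (α j.succ i : ℝ)

/-- `M̂`: the matrix with columns `α(1) - y, …, α(n) - y`. -/
def matMhat (α : Fin (n + 1) → Fin n → ℤ) (y : Fin n → ℤ) : Matrix (Fin n) (Fin n) ℝ :=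
  Matrix.of fun i j => (α j.succ i : ℝ) - (y i : ℝ)

/-- The determinant of the matrix obtained from `N` by replacing the `j`-th column by `y`. -/
def detCol (N : Matrix (Fin n) (Fin n) ℝ) (y : Fin n → ℤ) (j : Fin n) : ℝ :=
  (N.updateCol j fun i => (y i : ℝ)).det

/-- `Θ̂ = ∏ (det M̂ · b_i / det M̂_i) ^ (det M_i / det M)`, with principal powers (the modulus of
`Θ̂` does not depend on the branches, as the exponents are real). -/
def thetaHat (α : Fin (n + 1) → Fin n → ℤ) (y : Fin n → ℤ) (b : Fin (n + 1) → ℂ) : ℂ :=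
  ∏ i : Fin n, (((matMhat α y).det : ℂ) * b i.succ / (detCol (matMhat α y) y i : ℂ)) ^
    ((detCol (matM α) y i / (matM α).det : ℝ) : ℂ)

end Simplex

end AmoebaDisc

end

/-! Write `y` as a barycentric combination of the `α(i)` with coprime positive integer weights `q
i`, and let `p` be their sum. Affine relations among the `α(i)` and `y` form a line spanned by the
one with coefficients `q i` and `-p`. At a singular zero `z` the terms of `f` form such a relation,
so `p b_i z^α(i) = -q_i c z^y` for every `i` (`mem_nablaZero_iff`). Eliminating `z` leaves one
binomial equation, and coprimality of the weights makes it sufficient (`exists_isSingularZero_iff`).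

The equations at a singular zero also parametrize `∇₀` by monomials, so its vanishing ideal is the
kernel of a map between polynomial rings, hence prime. Division by the binomial with respect to `c`
leaves a remainder of degree less than `p`, on which that map is injective; hence the binomial
generates the ideal (`vanishingIdeal_eq_span`). With coprime integer coefficients it is the
discriminant.

The modulus of the binomial equation is the formula for `|c|`, by Cramer's rule (`norm_eq_iff`); its
phase is supplied by extreme opposition (`binomialRel_of_extremeOpposition`).

For the amoeba, take a singular zero `z` and restrict `f_κ` to the arguments of `z`. Up to a unit
and a positive factor it becomes `κ - potential`, and the potential has minimum `|c|`, attained at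
`log |z|`. For `κ > |c|` the monomial `y` therefore dominates at `log |z|`. At `κ = |c|` a point of
order `y` would, after a slight increase of `κ`, have the same winding number along some integer
direction as a dominated point near `log |z|`. The argument principle then forbids zeros between the
two, but the intermediate value theorem produces one (`orderComponent_eq_empty`). -/

namespace AmoebaDisc

/-! ### Winding numbers of exponential sums and the argument principle. -/

section Winding

variable {ι : Type*} [Fintype ι]

/-- The exponential sum `∑ aᵢ exp (i mᵢ s)`. -/
noncomputable def expSum (m : ι → ℤ) (a : ι → ℂ) (s : ℝ) : ℂ :=
  ∑ i, a i * Complex.exp (m i * s * Complex.I)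

/-- The winding number around the origin of the closed curve `s ↦ ∑ aᵢ exp (i mᵢ s)`. -/
noncomputable def winding (m : ι → ℤ) (a : ι → ℂ) : ℂ :=
  (2 * Real.pi : ℂ)⁻¹ *
    ∫ s in (0 : ℝ)..2 * Real.pi, expSum m (fun i => m i * a i) s / expSum m a s

theorem continuous_expSum_uncurry (m : ι → ℤ) :
    Continuous fun p : (ι → ℂ) × ℝ => expSum m p.1 p.2 := by
  unfold expSum; fun_prop

theorem continuous_expSum (m : ι → ℤ) (a : ι → ℂ) : Continuous (expSum m a) := by
  unfold expSum; fun_prop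

theorem hasDerivAt_expSum (m : ι → ℤ) (a : ι → ℂ) (s : ℝ) :
    HasDerivAt (expSum m a) (Complex.I * expSum m (fun i => m i * a i) s) s := by
  unfold expSum
  rw [Finset.mul_sum]
  refine HasDerivAt.fun_sum fun i _ => ?_
  have h : HasDerivAt (fun s : ℝ => (m i * s * Complex.I : ℂ)) (m i * 1 * Complex.I) s :=
    ((Complex.ofRealCLM.hasDerivAt (x := s)).const_mul (m i : ℂ)).mul_const Complex.I
  refine (h.cexp.const_mul (a i)).congr_deriv ?_
  ring

theorem expSum_two_pi (m : ι → ℤ) (a : ι → ℂ) : expSum m a (2 * Real.pi) = expSum m a 0 := by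
  refine Finset.sum_congr rfl fun i _ => ?_
  have : Complex.exp (m i * ((2 * Real.pi : ℝ) : ℂ) * Complex.I) = 1 :=
    Complex.exp_eq_one_iff.2 ⟨m i, by push_cast; ring⟩
  rw [this]; simp

/-- Dividing the curve by the exponential of the integral of its logarithmic derivative gives a
constant. As the curve closes up, that exponential is 1 after a full period. -/
theorem exists_int_winding {m : ι → ℤ} {a : ι → ℂ} (h : ∀ s, expSum m a s ≠ 0) :
    ∃ k : ℤ, winding m a = k := by
  set q : ℝ → ℂ := fun s => expSum m (fun i => m i * a i) s / expSum m a s with hq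
  have hqc : Continuous q := (continuous_expSum _ _).div (continuous_expSum _ _) h
  have hd : ∀ s, HasDerivAt
      (fun s => expSum m a s * Complex.exp (-Complex.I * ∫ t in (0 : ℝ)..s, q t)) 0 s := by
    intro s
    have h1 := (intervalIntegral.integral_hasDerivAt_right (hqc.intervalIntegrable 0 s)
      (hqc.stronglyMeasurableAtFilter _ _) hqc.continuousAt)
    refine ((hasDerivAt_expSum m a s).mul (h1.const_mul (-Complex.I)).cexp).congr_deriv ?_
    have := h s
    simp only [q]
    field_simp
    ring
  have hc := is_const_of_deriv_eq_zero (fun s => (hd s).differentiableAt) (fun s => (hd s).deriv)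
    (2 * Real.pi) 0
  simp only [expSum_two_pi, intervalIntegral.integral_same, mul_zero, Complex.exp_zero] at hc
  obtain ⟨k, hk⟩ := Complex.exp_eq_one_iff.1 (mul_left_cancel₀ (h 0) hc)
  refine ⟨-k, ?_⟩
  have hI : (∫ t in (0 : ℝ)..2 * Real.pi, q t) = -k * (2 * Real.pi) := by
    have : Complex.I * (-Complex.I * ∫ t in (0 : ℝ)..2 * Real.pi, q t) =
        Complex.I * (k * (2 * Real.pi * Complex.I)) := by rw [hk]
    linear_combination this + (k * (2 * Real.pi) + (∫ t in (0 : ℝ)..2 * Real.pi, q t)) *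
      Complex.I_mul_I
  rw [winding, hI]
  have : (Real.pi : ℂ) ≠ 0 := by exact_mod_cast Real.pi_ne_zero
  push_cast
  field_simp

theorem continuous_winding {X : Type*} [TopologicalSpace X] {m : ι → ℤ}
    {a : X → ι → ℂ} (ha : Continuous a) (h : ∀ x s, expSum m (a x) s ≠ 0) :
    Continuous fun x => winding m (a x) := by
  refine continuous_const.mul
    (intervalIntegral.continuous_parametric_intervalIntegral_of_continuous' ?_ _ _)
  refine Continuous.div ?_ ?_ fun p => h p.1 p.2
  · exact (continuous_expSum_uncurry m).comp (f := fun p : X × ℝ => (fun i => m i * a p.1 i, p.2))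
      (by fun_prop)
  · exact (continuous_expSum_uncurry m).comp (f := fun p : X × ℝ => (a p.1, p.2)) (by fun_prop)

/-- A continuous integer-valued function on a preconnected space is constant. -/
theorem winding_eq_winding {X : Type*} [TopologicalSpace X] [PreconnectedSpace X] {m : ι → ℤ}
    {a : X → ι → ℂ} (ha : Continuous a) (h : ∀ x s, expSum m (a x) s ≠ 0) (x y : X) :
    winding m (a x) = winding m (a y) := by
  choose k hk using fun x => exists_int_winding (h x)
  have hc : Continuous k := by
    rw [Int.isClosedEmbedding_coe_real.isInducing.continuous_iff]
    have : (fun n : ℤ => (n : ℝ)) ∘ k = fun x => (winding m (a x)).re := by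
      funext x; simp [hk]
    exact this ▸ Complex.continuous_re.comp (continuous_winding ha h)
  rw [hk, hk, PreconnectedSpace.constant inferInstance hc (x := x) (y := y)]

theorem norm_cexp_int_mul (k : ℤ) (s : ℝ) : ‖Complex.exp (k * s * Complex.I)‖ = 1 := by
  have := Complex.norm_exp_ofReal_mul_I (k * s)
  push_cast at this
  exact this

theorem expSum_ne_zero_of_lopsided [DecidableEq ι] (m : ι → ℤ) {a : ι → ℂ} {i₀ : ι}
    (h : ∑ i ∈ Finset.univ.erase i₀, ‖a i‖ < ‖a i₀‖) (s : ℝ) : expSum m a s ≠ 0 := by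
  intro h0
  rw [expSum, ← Finset.add_sum_erase _ _ (Finset.mem_univ i₀)] at h0
  have h1 : ‖a i₀‖ ≤ ∑ i ∈ Finset.univ.erase i₀, ‖a i‖ := by
    calc ‖a i₀‖ = ‖a i₀ * Complex.exp (m i₀ * s * Complex.I)‖ := by
          rw [norm_mul, norm_cexp_int_mul, mul_one]
      _ = ‖∑ i ∈ Finset.univ.erase i₀, a i * Complex.exp (m i * s * Complex.I)‖ := by
          rw [eq_neg_of_add_eq_zero_left h0, norm_neg]
      _ ≤ _ := (norm_sum_le _ _).trans_eq
          (Finset.sum_congr rfl fun i _ => by rw [norm_mul, norm_cexp_int_mul, mul_one])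
  exact absurd h (not_lt.2 h1)

/-- Shrinking all other terms to zero never creates a zero of the sum; at the end a single term
remains, whose logarithmic derivative is constant. -/
theorem winding_of_lopsided [DecidableEq ι] (m : ι → ℤ) {a : ι → ℂ} {i₀ : ι}
    (h : ∑ i ∈ Finset.univ.erase i₀, ‖a i‖ < ‖a i₀‖) : winding m a = m i₀ := by
  let b : unitInterval → ι → ℂ := fun σ i => (if i = i₀ then 1 else ((σ : ℝ) : ℂ)) * a i
  have hb : Continuous b := by
    refine continuous_pi fun i => ?_
    by_cases hi : i = i₀ <;> simp only [b, hi, if_true, if_false] <;> fun_prop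
  have hne : ∀ σ s, expSum m (b σ) s ≠ 0 := by
    intro σ
    refine expSum_ne_zero_of_lopsided m (i₀ := i₀) (lt_of_le_of_lt ?_ (h.trans_eq ?_))
    · refine Finset.sum_le_sum fun i hi => ?_
      simp only [b, Finset.ne_of_mem_erase hi, if_false, norm_mul, Complex.norm_real]
      refine mul_le_of_le_one_left (norm_nonneg _) ?_
      rw [Real.norm_of_nonneg σ.2.1]; exact σ.2.2
    · simp [b]
  have h1 : b 1 = a := by funext i; simp [b]
  have h0 := winding_eq_winding hb hne 1 0
  rw [h1] at h0
  rw [h0, winding]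
  have hz : ∀ s, expSum m (fun i => m i * b 0 i) s / expSum m (b 0) s = m i₀ := by
    intro s
    have e : expSum m (fun i => m i * b 0 i) s = m i₀ * expSum m (b 0) s := by
      rw [expSum, expSum, Finset.mul_sum]
      refine Finset.sum_congr rfl fun i _ => ?_
      by_cases hi : i = i₀
      · subst hi; ring
      · simp [b, hi]
    rw [e, mul_div_cancel_right₀ _ (hne 0 s)]
  simp only [hz, intervalIntegral.integral_const, sub_zero]
  have : (Real.pi : ℂ) ≠ 0 := by exact_mod_cast Real.pi_ne_zero
  rw [Complex.real_smul]
  push_cast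
  field_simp

theorem circleIntegral_sum_inv_sub {R : ℝ} (hR : 0 < R) (S : Multiset ℂ)
    (hS : ∀ x ∈ S, ‖x‖ ≠ R) :
    CircleIntegrable (fun z => (S.map fun x => 1 / (z - x)).sum) 0 R ∧
    (∮ z in C(0, R), (S.map fun x => 1 / (z - x)).sum) =
      2 * Real.pi * Complex.I * (S.filter fun x => ‖x‖ < R).card := by
  induction S using Multiset.induction_on with
  | empty => simp [circleIntegrable_const, circleIntegral]
  | cons x S ih =>
    obtain ⟨h1, h2⟩ := ih fun y hy => hS y (Multiset.mem_cons_of_mem hy)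
    have hx := hS x (Multiset.mem_cons_self x S)
    have h3 : CircleIntegrable (fun z => 1 / (z - x)) 0 R := by
      refine ContinuousOn.circleIntegrable hR.le (ContinuousOn.div (by fun_prop) (by fun_prop) ?_)
      intro z hz h0
      rw [sub_eq_zero.1 h0] at hz
      exact hx (by simpa using hz)
    have h4 : (∮ z in C(0, R), 1 / (z - x)) =
        2 * Real.pi * Complex.I * (if ‖x‖ < R then 1 else 0) := by
      simp only [one_div]
      split_ifs with hlt
      · rw [circleIntegral.integral_sub_inv_of_mem_ball (by simpa using hlt), mul_one]
      · rw [mul_zero]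
        have hne : ∀ z ∈ Metric.closedBall (0 : ℂ) R, z - x ≠ 0 := by
          intro z hz h0
          rw [sub_eq_zero.1 h0] at hz
          exact hx (le_antisymm (by simpa using hz) (not_lt.1 hlt))
        refine Complex.circleIntegral_eq_zero_of_differentiable_on_off_countable hR.le
          Set.countable_empty (ContinuousOn.inv₀ (by fun_prop) hne) ?_
        intro z hz
        exact DifferentiableAt.inv (by fun_prop) (hne z (Metric.ball_subset_closedBall hz.1))
    simp only [Multiset.map_cons, Multiset.sum_cons, Multiset.filter_cons]
    refine ⟨h3.add h1, ?_⟩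
    rw [circleIntegral.integral_add h3 h1, h2, h4]
    split_ifs <;> simp; ring

/-- The polynomial `z ^ K ∑ aᵢ z ^ mᵢ`. -/
noncomputable def clearedPoly (m : ι → ℤ) (a : ι → ℂ) (K : ℤ) : Polynomial ℂ :=
  ∑ i, Polynomial.monomial (m i + K).toNat (a i)

theorem eval_clearedPoly {m : ι → ℤ} (a : ι → ℂ) {K : ℤ} (hK : ∀ i, 0 ≤ m i + K) {z : ℂ}
    (hz : z ≠ 0) : (clearedPoly m a K).eval z = z ^ K * ∑ i, a i * z ^ m i := by
  rw [clearedPoly, Polynomial.eval_finsetSum, Finset.mul_sum]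
  refine Finset.sum_congr rfl fun i _ => ?_
  rw [Polynomial.eval_monomial, ← zpow_natCast, Int.toNat_of_nonneg (hK i), zpow_add₀ hz]
  ring

theorem eval_derivative_clearedPoly {m : ι → ℤ} (a : ι → ℂ) {K : ℤ} (hK : ∀ i, 0 ≤ m i + K)
    {z : ℂ} (hz : z ≠ 0) : z * (clearedPoly m a K).derivative.eval z =
      z ^ K * (∑ i, m i * a i * z ^ m i + K * ∑ i, a i * z ^ m i) := by
  rw [clearedPoly, Polynomial.derivative_sum, Polynomial.eval_finsetSum, Finset.mul_sum,
    Finset.mul_sum, ← Finset.sum_add_distrib, Finset.mul_sum]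
  refine Finset.sum_congr rfl fun i _ => ?_
  rw [Polynomial.derivative_monomial, Polynomial.eval_monomial]
  have hcast : (((m i + K).toNat : ℕ) : ℂ) = m i + K := by
    rw [← Int.cast_natCast, Int.toNat_of_nonneg (hK i)]; push_cast; ring
  rw [hcast]
  -- In degree 0 the truncated exponent is wrong, but there the factor `m i + K` vanishes.
  by_cases h0 : (m i + K).toNat = 0
  · have : (m i + K : ℂ) = 0 := by rw [← hcast, h0]; simp
    linear_combination (z * a i * z ^ ((m i + K).toNat - 1) - z ^ K * a i * z ^ m i) * this
  · have h1 : z * z ^ ((m i + K).toNat - 1) = z ^ K * z ^ m i := by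
      rw [mul_comm, pow_sub_one_mul h0, ← zpow_natCast, Int.toNat_of_nonneg (hK i),
        zpow_add₀ hz]
      ring
    linear_combination a i * (m i + K) * h1

theorem expSum_mul_zpow (m : ι → ℤ) (a : ι → ℂ) (r s : ℝ) :
    expSum m (fun i => a i * (r : ℂ) ^ m i) s = ∑ i, a i * circleMap 0 r s ^ m i := by
  refine Finset.sum_congr rfl fun i _ => ?_
  rw [circleMap_zero, mul_zpow, ← Complex.exp_int_mul]
  ring_nf

/-- Argument principle: `z p'/p` is the logarithmic derivative of the sum plus `K`, and `p'/p` is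
the sum of `1/(z - x)` over the roots `x`. -/
theorem winding_eq_card_roots {m : ι → ℤ} (a : ι → ℂ) {K : ℤ} (hK : ∀ i, 0 ≤ m i + K) {r : ℝ}
    (hr : 0 < r) (h : ∀ s, expSum m (fun i => a i * (r : ℂ) ^ m i) s ≠ 0) :
    winding m (fun i => a i * (r : ℂ) ^ m i) =
      ((clearedPoly m a K).roots.filter fun x => ‖x‖ < r).card - K := by
  set p := clearedPoly m a K with hp
  have hc0 : ∀ s, circleMap 0 r s ≠ 0 := fun s => circleMap_ne_center hr.ne'
  have hev : ∀ s, p.eval (circleMap 0 r s) ≠ 0 := by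
    intro s
    rw [eval_clearedPoly a hK (hc0 s), ← expSum_mul_zpow]
    exact mul_ne_zero (zpow_ne_zero _ (hc0 s)) (h s)
  have hroot : ∀ x ∈ p.roots, ‖x‖ ≠ r := by
    intro x hx hxr
    have : x ∈ Metric.sphere (0 : ℂ) |r| := by simpa [abs_of_pos hr] using hxr
    rw [← range_circleMap] at this
    obtain ⟨s, rfl⟩ := this
    exact hev s (Polynomial.isRoot_of_mem_roots hx)
  have h1 := (circleIntegral_sum_inv_sub hr p.roots hroot).2
  have h2 : (∮ z in C(0, r), (p.roots.map fun x => 1 / (z - x)).sum) =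
      ∫ s in (0 : ℝ)..2 * Real.pi, Complex.I * (expSum m (fun i => m i * (a i * (r : ℂ) ^ m i)) s /
        expSum m (fun i => a i * (r : ℂ) ^ m i) s + K) := by
    refine intervalIntegral.integral_congr fun s _ => ?_
    have hs := h s
    have e1 := eval_clearedPoly a hK (hc0 s)
    have e2 := eval_derivative_clearedPoly a hK (hc0 s)
    have e3 := (IsAlgClosed.splits p).eval_derivative_div_eval_of_ne_zero (hev s)
    have e4 := expSum_mul_zpow m (fun i => m i * a i) r s
    simp only [mul_assoc] at e2 e4
    have key : circleMap 0 r s * (p.derivative.eval (circleMap 0 r s) / p.eval (circleMap 0 r s)) =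
        expSum m (fun i => m i * (a i * (r : ℂ) ^ m i)) s /
          expSum m (fun i => a i * (r : ℂ) ^ m i) s + K := by
      rw [mul_div_assoc', e2, e1, mul_div_mul_left _ _ (zpow_ne_zero K (hc0 s)), e4,
        expSum_mul_zpow, add_div, mul_div_cancel_right₀]
      rwa [← expSum_mul_zpow]
    simp only [deriv_circleMap, smul_eq_mul]
    rw [← e3, ← key]
    ring
  rw [h2, intervalIntegral.integral_const_mul, intervalIntegral.integral_add, 
    intervalIntegral.integral_const] at h1
  · rw [winding]
    have hpi : (Real.pi : ℂ) ≠ 0 := by exact_mod_cast Real.pi_ne_zero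
    have h5 := mul_left_cancel₀ Complex.I_ne_zero (h1.trans (mul_assoc _ _ _ |>.trans
      (mul_left_comm _ _ _)))
    rw [eq_sub_iff_add_eq', ← mul_right_inj' (mul_ne_zero two_ne_zero hpi), ← h5, mul_add,
      mul_inv_cancel_left₀ (mul_ne_zero two_ne_zero hpi), Complex.real_smul]
    push_cast
    ring
  · exact ((continuous_expSum _ _).div (continuous_expSum _ _) h).intervalIntegrable _ _
  · exact intervalIntegrable_const

/-- Equal winding numbers mean equally many roots in two concentric discs. The smaller multiset of
roots is contained in the larger, so they coincide and the annulus contains none. -/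
theorem ne_zero_of_winding_eq {m : ι → ℤ} {a : ι → ℂ} {r₁ r₂ : ℝ} (hr₁ : 0 < r₁)
    (h₁ : ∀ s, expSum m (fun i => a i * (r₁ : ℂ) ^ m i) s ≠ 0)
    (h₂ : ∀ s, expSum m (fun i => a i * (r₂ : ℂ) ^ m i) s ≠ 0)
    (hw : winding m (fun i => a i * (r₁ : ℂ) ^ m i) = winding m (fun i => a i * (r₂ : ℂ) ^ m i))
    {z : ℂ} (hz₁ : r₁ < ‖z‖) (hz₂ : ‖z‖ < r₂) : ∑ i, a i * z ^ m i ≠ 0 := by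
  intro h0
  have hK : ∀ i, 0 ≤ m i + ∑ j, |m j| := fun i => by
    have := Finset.single_le_sum (f := fun j => |m j|) (fun j _ => abs_nonneg _)
      (Finset.mem_univ i)
    have := neg_abs_le (m i)
    linarith
  have hz : z ≠ 0 := norm_pos_iff.1 (hr₁.trans hz₁)
  rw [winding_eq_card_roots a hK hr₁ h₁,
    winding_eq_card_roots a hK (hr₁.trans (hz₁.trans hz₂)) h₂] at hw
  set p := clearedPoly m a (∑ j, |m j|) with hp
  have hp0 : p ≠ 0 := by
    intro hp0
    have hc0 : circleMap 0 r₁ 0 ≠ 0 := circleMap_ne_center hr₁.ne'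
    have := eval_clearedPoly a hK hc0
    rw [← hp, hp0, Polynomial.eval_zero, ← expSum_mul_zpow] at this
    exact mul_ne_zero (zpow_ne_zero _ hc0) (h₁ 0) this.symm
  have hzr : z ∈ p.roots := by
    rw [Polynomial.mem_roots hp0, Polynomial.IsRoot, eval_clearedPoly a hK hz, h0, mul_zero]
  have hcard : (p.roots.filter fun x => ‖x‖ < r₁).card =
      (p.roots.filter fun x => ‖x‖ < r₂).card := by exact_mod_cast sub_left_injective hw
  have hle : (p.roots.filter fun x => ‖x‖ < r₁) ≤ (p.roots.filter fun x => ‖x‖ < r₂) :=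
    Multiset.monotone_filter_right _ fun x hx => hx.trans (hz₁.trans hz₂)
  have heq := Multiset.eq_of_le_of_card_le hle hcard.ge
  have : z ∈ p.roots.filter fun x => ‖x‖ < r₁ := heq ▸ Multiset.mem_filter.2 ⟨hzr, hz₂⟩
  exact absurd (Multiset.mem_filter.1 this).2 (not_lt.2 hz₁.le)

end Winding

/-! ### Averages over the torus as winding numbers. -/

section TorusAverage

open MeasureTheory

variable {n : ℕ}

/-- Up to null sets, the cube and its translate are both fundamental domains of the period lattice.
-/
theorem setIntegral_Icc_add_eq {f : (Fin n → ℝ) → ℂ}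
    (hf : ∀ (j : Fin n) θ, f (Pi.single j (2 * Real.pi) + θ) = f θ) (a : Fin n → ℝ) :
    ∫ θ in Set.Icc (0 : Fin n → ℝ) (fun _ => 2 * Real.pi), f (a + θ) =
      ∫ θ in Set.Icc (0 : Fin n → ℝ) (fun _ => 2 * Real.pi), f θ := by
  have hpi := Real.two_pi_pos
  let e := (Pi.basisFun ℝ (Fin n)).isUnitSMul (w := fun _ => 2 * Real.pi)
    (fun _ => hpi.ne'.isUnit)
  have he : ∀ j, e j = Pi.single j (2 * Real.pi) := fun j => by
    funext k
    by_cases h : k = j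
    · subst h; simp [e, Module.Basis.isUnitSMul_apply]
    · simp [e, Module.Basis.isUnitSMul_apply, h]
  have hD : ZSpan.fundamentalDomain e = Set.pi Set.univ fun _ => Set.Ico 0 (2 * Real.pi) := by
    ext θ
    have h1 : ∀ i, e.repr θ i = θ i / (2 * Real.pi) := by
      intro i
      have h2 : θ = ∑ j, (θ j / (2 * Real.pi)) • e j := by
        funext k
        simp only [he, Finset.sum_apply, Pi.smul_apply, smul_eq_mul, Pi.single_apply, mul_ite,
          mul_zero, Finset.sum_ite_eq, Finset.mem_univ, if_true]
        field_simp
      conv_lhs => rw [h2]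
      rw [Module.Basis.repr_sum_self]
    simp only [ZSpan.mem_fundamentalDomain, h1, Set.mem_Ico, Set.mem_pi, Set.mem_univ,
      true_implies, le_div_iff₀ hpi, div_lt_iff₀ hpi, zero_mul, one_mul]
  have hae : Set.Icc (0 : Fin n → ℝ) (fun _ => 2 * Real.pi) =ᵐ[volume]
      ZSpan.fundamentalDomain e := by
    rw [hD]; exact Measure.univ_pi_Ico_ae_eq_Icc.symm
  have hfun := ZSpan.isAddFundamentalDomain' e (volume : Measure (Fin n → ℝ))
  have : Countable (Submodule.span ℤ (Set.range e)).toAddSubgroup :=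
    inferInstanceAs (Countable (Submodule.span ℤ (Set.range e)))
  have hinv : ∀ (g : (Submodule.span ℤ (Set.range e)).toAddSubgroup) (x : Fin n → ℝ), f (g +ᵥ x) = f x := by
    rintro ⟨g, hg⟩
    change ∀ x, f (g + x) = f x
    induction hg using Submodule.span_induction with
    | mem g hg => obtain ⟨j, rfl⟩ := hg; rw [he]; exact hf j
    | zero => simp
    | add x y _ _ hx hy => intro z; rw [add_assoc, hx, hy]
    | smul k x _ hx =>
      induction k using Int.induction_on with
      | zero => simp
      | succ i ih => intro z; rw [add_smul, one_smul, add_assoc, ih, hx]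
      | pred i ih =>
        intro z
        have h3 := hx ((-(i : ℤ) - 1) • x + z)
        rw [← h3, sub_smul, one_smul]
        have : x + ((-(i : ℤ)) • x - x + z) = (-(i : ℤ)) • x + z := by abel
        rw [this, ih]
  rw [setIntegral_congr_set hae, setIntegral_congr_set hae]
  have h4 := (measurePreserving_add_left volume a).setIntegral_image_emb
    (measurableEmbedding_addLeft a) f (ZSpan.fundamentalDomain e)
  rw [← h4]
  exact (hfun.vadd_of_comm a).setIntegral_eq hfun hinv

/-- The pairing of an integer vector with a real vector. -/
def pair (a : Fin n → ℤ) (x : Fin n → ℝ) : ℝ := ∑ k, a k * x k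

theorem pair_add (a : Fin n → ℤ) (x y : Fin n → ℝ) : pair a (x + y) = pair a x + pair a y := by
  simp [pair, mul_add, Finset.sum_add_distrib]

theorem pair_smul (a : Fin n → ℤ) (t : ℝ) (x : Fin n → ℝ) : pair a (t • x) = t * pair a x := by
  simp only [pair, Finset.mul_sum, Pi.smul_apply, smul_eq_mul]
  exact Finset.sum_congr rfl fun _ _ => by ring

theorem pair_intCast (a v : Fin n → ℤ) : pair a (fun k => v k) = ((a ⬝ᵥ v : ℤ) : ℝ) := by
  simp [pair, dotProduct]

theorem continuous_pair (a : Fin n → ℤ) : Continuous (pair a) := by unfold pair; fun_prop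

variable {ι : Type*}

/-- The coefficients `βᵢ` rotated by the phases `⟨Aᵢ, θ⟩`. -/
noncomputable def rotate (A : ι → Fin n → ℤ) (β : ι → ℂ) (θ : Fin n → ℝ) (i : ι) : ℂ :=
  β i * Complex.exp (pair (A i) θ * Complex.I)

theorem continuous_rotate (A : ι → Fin n → ℤ) (β : ι → ℂ) : Continuous (rotate A β) := by
  refine continuous_pi fun i => ?_
  have := continuous_pair (A i)
  unfold rotate
  fun_prop

theorem rotate_mul (A : ι → Fin n → ℤ) (c β : ι → ℂ) (θ : Fin n → ℝ) :
    rotate A (fun i => c i * β i) θ = fun i => c i * rotate A β θ i := by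
  funext i; simp [rotate, mul_assoc]

theorem expSum_rotate [Fintype ι] (A : ι → Fin n → ℤ) (β : ι → ℂ) (θ : Fin n → ℝ) (v : Fin n → ℤ) (s : ℝ) :
    expSum (fun i => A i ⬝ᵥ v) (rotate A β θ) s =
      ∑ i, rotate A β (s • (fun k => (v k : ℝ)) + θ) i := by
  refine Finset.sum_congr rfl fun i _ => ?_
  rw [rotate, rotate, pair_add, pair_smul, pair_intCast, mul_assoc, ← Complex.exp_add]
  congr 2
  push_cast
  ring

theorem rotate_single_add (A : ι → Fin n → ℤ) (β : ι → ℂ) (j : Fin n) (θ : Fin n → ℝ) :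
    rotate A β (Pi.single j (2 * Real.pi) + θ) = rotate A β θ := by
  funext i
  have : pair (A i) (Pi.single j (2 * Real.pi)) = A i j * (2 * Real.pi) := by
    simp [pair, Pi.single_apply]
  rw [rotate, rotate, pair_add, this]
  congr 1
  push_cast
  rw [add_mul, Complex.exp_add, mul_assoc, Complex.exp_int_mul_two_pi_mul_I, one_mul]

/-- The winding number along the direction `v` is the average over the torus of the logarithmic
derivative in the direction `v`. -/
theorem setIntegral_logDeriv_eq_winding [Fintype ι] (A : ι → Fin n → ℤ) {β : ι → ℂ}
    (h : ∀ θ, ∑ i, rotate A β θ i ≠ 0) (v : Fin n → ℤ) (θ₀ : Fin n → ℝ) :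
    ∫ θ in Set.Icc (0 : Fin n → ℝ) (fun _ => 2 * Real.pi),
      (∑ i, ((A i ⬝ᵥ v : ℤ) : ℂ) * rotate A β θ i) / ∑ i, rotate A β θ i =
    (2 * Real.pi : ℂ) ^ n * winding (fun i => A i ⬝ᵥ v) (rotate A β θ₀) := by
  set D : (Fin n → ℝ) → ℂ := fun θ =>
    (∑ i, ((A i ⬝ᵥ v : ℤ) : ℂ) * rotate A β θ i) / ∑ i, rotate A β θ i with hD
  have hcr : ∀ i, Continuous fun θ => rotate A β θ i := fun i =>
    (continuous_apply i).comp (continuous_rotate A β)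
  have hDc : Continuous D := Continuous.div (by fun_prop) (by fun_prop) h
  have hper : ∀ (j : Fin n) θ, D (Pi.single j (2 * Real.pi) + θ) = D θ := by
    intro j θ; simp only [hD, rotate_single_add]
  have hne : ∀ θ s, expSum (fun i => A i ⬝ᵥ v) (rotate A β θ) s ≠ 0 := fun θ s => by
    rw [expSum_rotate]; exact h _
  have hw : ∀ θ, winding (fun i => A i ⬝ᵥ v) (rotate A β θ) =
      (2 * Real.pi : ℂ)⁻¹ * ∫ s in (0 : ℝ)..2 * Real.pi, D (s • (fun k => (v k : ℝ)) + θ) := by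
    intro θ
    rw [winding]
    congr 1
    refine intervalIntegral.integral_congr fun s _ => ?_
    simp only [hD]
    rw [← expSum_rotate, ← rotate_mul A (fun i => ((A i ⬝ᵥ v : ℤ) : ℂ)), expSum_rotate,
      rotate_mul]
  have hvol : (volume.real (Set.Icc (0 : Fin n → ℝ) fun _ => 2 * Real.pi)) =
      (2 * Real.pi) ^ n := by
    rw [measureReal_def, Real.volume_Icc_pi_toReal]
    · simp
    · intro i; exact Real.two_pi_pos.le
  have hpi : (Real.pi : ℂ) ≠ 0 := by exact_mod_cast Real.pi_ne_zero
  -- The space of angles is connected, so the winding number does not depend on the base point and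
  -- averaging over it changes nothing.
  have h1 : ∫ θ in Set.Icc (0 : Fin n → ℝ) (fun _ => 2 * Real.pi),
      winding (fun i => A i ⬝ᵥ v) (rotate A β θ) =
      (2 * Real.pi : ℂ) ^ n * winding (fun i => A i ⬝ᵥ v) (rotate A β θ₀) := by
    rw [setIntegral_congr_fun measurableSet_Icc fun θ _ =>
      winding_eq_winding (continuous_rotate A β) hne θ θ₀, setIntegral_const, hvol,
      Complex.real_smul]
    push_cast; ring
  rw [← h1]
  simp only [hw]
  rw [integral_const_mul, eq_inv_mul_iff_mul_eq₀ (mul_ne_zero two_ne_zero hpi)]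
  simp only [intervalIntegral.integral_of_le Real.two_pi_pos.le]
  -- After Fubini the inner integral is that of a periodic function translated by `s v`, so `s`
  -- drops out.
  rw [integral_integral_swap]
  · simp only [setIntegral_Icc_add_eq hper]
    rw [setIntegral_const]
    simp [Real.pi_pos.le]
  · have hc : Continuous fun p : (Fin n → ℝ) × ℝ => D (p.2 • (fun k => (v k : ℝ)) + p.1) := by
      fun_prop
    rw [Measure.prod_restrict]
    exact (hc.continuousOn.integrableOn_compact
      (isCompact_Icc.prod isCompact_Icc)).mono_set
      (Set.prod_mono subset_rfl Set.Ioc_subset_Icc_self)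

end TorusAverage

/-! ### The order of a point of the amoeba complement. -/

section Order

variable {n : ℕ} {ι : Type*} [Fintype ι]

theorem monom_exp (a : Fin n → ℤ) (w θ : Fin n → ℝ) :
    monom a (fun k => Real.exp (w k) * Complex.exp (θ k * Complex.I)) =
      Real.exp (pair a w) * Complex.exp (pair a θ * Complex.I) := by
  rw [monom]
  simp only [mul_zpow, Finset.prod_mul_distrib, ← Complex.exp_int_mul, Complex.ofReal_exp]
  rw [← Complex.exp_sum, ← Complex.exp_sum]
  simp only [pair]
  push_cast
  rw [Finset.sum_mul]
  simp only [mul_assoc]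

/-- The coefficients of the restriction of a Laurent polynomial to the torus `|z| = exp w`. -/
noncomputable def scaled (A : ι → Fin n → ℤ) (b : ι → ℂ) (w : Fin n → ℝ) (i : ι) : ℂ :=
  b i * Real.exp (pair (A i) w)

theorem laurent_exp (A : ι → Fin n → ℤ) (b : ι → ℂ) (w θ : Fin n → ℝ) :
    laurent A b (fun k => Real.exp (w k) * Complex.exp (θ k * Complex.I)) =
      ∑ i, rotate A (scaled A b w) θ i := by
  simp only [laurent, monom_exp, rotate, scaled, mul_assoc]

theorem notMem_amoeba_iff (A : ι → Fin n → ℤ) (b : ι → ℂ) (w : Fin n → ℝ) :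
    w ∉ amoeba A b ↔ ∀ θ, ∑ i, rotate A (scaled A b w) θ i ≠ 0 := by
  constructor
  · intro h θ h0
    refine h ⟨fun k => Real.exp (w k) * Complex.exp (θ k * Complex.I), fun k => ?_, ?_, ?_⟩
    · exact mul_ne_zero (by exact_mod_cast (Real.exp_pos _).ne') (Complex.exp_ne_zero _)
    · rw [laurent_exp, h0]
    · intro k
      rw [norm_mul, Complex.norm_exp_ofReal_mul_I, mul_one, Complex.norm_real,
        Real.norm_of_nonneg (Real.exp_pos _).le, Real.log_exp]
  · rintro h ⟨z, hz, h0, hw⟩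
    refine h (fun k => (z k).arg) ?_
    rw [← laurent_exp, ← h0]
    congr 1
    funext k
    rw [← hw, Real.exp_log (norm_pos_iff.2 (hz k)), Complex.norm_mul_exp_arg_mul_I]

theorem mul_partialDeriv_laurent (A : ι → Fin n → ℤ) (b : ι → ℂ) (j : Fin n) {z : Fin n → ℂ}
    (hz : z j ≠ 0) :
    z j * partialDeriv (laurent A b) j z = ∑ i, A i j * (b i * monom (A i) z) := by
  have hm : ∀ (a : Fin n → ℤ) (t : ℂ), monom a (Function.update z j t) =
      t ^ a j * ∏ k ∈ Finset.univ.erase j, z k ^ a k := by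
    intro a t
    rw [monom, ← Finset.mul_prod_erase _ _ (Finset.mem_univ j), Function.update_self]
    congr 1
    exact Finset.prod_congr rfl fun k hk => by
      rw [Function.update_of_ne (Finset.ne_of_mem_erase hk)]
  have hd : HasDerivAt (fun t => laurent A b (Function.update z j t))
      (∑ i, b i * (A i j * z j ^ (A i j - 1) * ∏ k ∈ Finset.univ.erase j, z k ^ A i k)) (z j) := by
    simp only [laurent, hm]
    refine HasDerivAt.fun_sum fun i _ => ?_
    exact ((hasDerivAt_zpow _ _ (Or.inl hz)).mul_const _).const_mul _
  rw [partialDeriv, hd.deriv, Finset.mul_sum]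
  refine Finset.sum_congr rfl fun i _ => ?_
  rw [monom, ← Finset.mul_prod_erase _ _ (Finset.mem_univ j), zpow_sub_one₀ hz]
  field_simp

/-- Since `dz_k = i z_k dθ_k`, the product of the `z_k` cancels and `i ^ n` cancels against `(2πi) ^
n`. -/
theorem order_eq_setIntegral (A : ι → Fin n → ℤ) (b : ι → ℂ) (w : Fin n → ℝ) (j : Fin n) :
    order A b w j = ((2 * Real.pi : ℂ) ^ n)⁻¹ *
      ∫ θ in Set.Icc (0 : Fin n → ℝ) (fun _ => 2 * Real.pi),
        (∑ i, (A i j : ℂ) * rotate A (scaled A b w) θ i) /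
          ∑ i, rotate A (scaled A b w) θ i := by
  have hz : ∀ (θ : Fin n → ℝ) k,
      (Real.exp (w k) * Complex.exp (θ k * Complex.I) : ℂ) ≠ 0 := fun θ k =>
    mul_ne_zero (by exact_mod_cast (Real.exp_pos _).ne') (Complex.exp_ne_zero _)
  have hmap : ∀ θ, torusMap (0 : Fin n → ℂ) (fun k => Real.exp (w k)) θ =
      fun k => (Real.exp (w k) * Complex.exp (θ k * Complex.I) : ℂ) := by
    intro θ; funext k; simp [torusMap]
  rw [order, torusIntegral, mul_pow, mul_inv, mul_assoc]
  congr 1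
  rw [← MeasureTheory.integral_const_mul]
  refine MeasureTheory.setIntegral_congr_fun measurableSet_Icc fun θ _ => ?_
  simp only [hmap]
  have hd := mul_partialDeriv_laurent A b j
    (z := fun k => Real.exp (w k) * Complex.exp (θ k * Complex.I)) (hz θ j)
  rw [hd, laurent_exp]
  simp only [monom_exp]
  rw [Finset.prod_mul_distrib, Finset.prod_const, Finset.card_univ, Fintype.card_fin,
    smul_eq_mul]
  have hp : ∏ k, (Real.exp (w k) * Complex.exp (θ k * Complex.I) : ℂ) ≠ 0 :=
    Finset.prod_ne_zero_iff.2 fun k _ => hz θ k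
  have hI : (Complex.I : ℂ) ^ n ≠ 0 := pow_ne_zero _ Complex.I_ne_zero
  have e : ∑ i, (A i j : ℂ) * (b i * (Real.exp (pair (A i) w) *
      Complex.exp (pair (A i) θ * Complex.I))) =
      ∑ i, (A i j : ℂ) * rotate A (scaled A b w) θ i := by
    simp only [rotate, scaled, mul_assoc]
  rw [e]
  generalize ∏ k, (Real.exp (w k) * Complex.exp (θ k * Complex.I) : ℂ) = P at hp ⊢
  field_simp

/-- This reduces the order, an integral in several variables, to the argument principle in one
variable along integer directions. -/
theorem sum_mul_order_eq_winding (A : ι → Fin n → ℤ) (b : ι → ℂ) {w : Fin n → ℝ}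
    (hw : w ∉ amoeba A b) (v : Fin n → ℤ) (θ : Fin n → ℝ) :
    ∑ j, v j * order A b w j =
      winding (fun i => A i ⬝ᵥ v) (rotate A (scaled A b w) θ) := by
  rw [notMem_amoeba_iff] at hw
  have hpi : (2 * Real.pi : ℂ) ^ n ≠ 0 :=
    pow_ne_zero _ (mul_ne_zero two_ne_zero (by exact_mod_cast Real.pi_ne_zero))
  rw [← mul_right_inj' hpi, ← setIntegral_logDeriv_eq_winding A hw v θ]
  have hcr : ∀ i, Continuous fun θ => rotate A (scaled A b w) θ i := fun i =>
    (continuous_apply i).comp (continuous_rotate A _)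
  have hint : ∀ j, MeasureTheory.IntegrableOn (fun θ => (v j : ℂ) *
      ((∑ i, (A i j : ℂ) * rotate A (scaled A b w) θ i) /
        ∑ i, rotate A (scaled A b w) θ i))
      (Set.Icc (0 : Fin n → ℝ) fun _ => 2 * Real.pi) := fun j =>
    (Continuous.mul continuous_const (Continuous.div (by fun_prop) (by fun_prop)
      hw)).continuousOn.integrableOn_compact isCompact_Icc
  simp only [order_eq_setIntegral, Finset.mul_sum]
  calc _ = ∑ j, ∫ θ in Set.Icc (0 : Fin n → ℝ) (fun _ => 2 * Real.pi), (v j : ℂ) *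
      ((∑ i, (A i j : ℂ) * rotate A (scaled A b w) θ i) /
        ∑ i, rotate A (scaled A b w) θ i) := by
        refine Finset.sum_congr rfl fun j _ => ?_
        rw [MeasureTheory.integral_const_mul]
        field_simp
    _ = _ := by
        rw [← MeasureTheory.integral_finsetSum _ fun j _ => hint j]
        refine MeasureTheory.setIntegral_congr_fun measurableSet_Icc fun θ _ => ?_
        simp only [dotProduct]
        simp only [mul_div_assoc', ← Finset.sum_div, Finset.mul_sum]
        rw [Finset.sum_comm]
        congr 1
        refine Finset.sum_congr rfl fun i _ => ?_
        push_cast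
        rw [Finset.sum_mul]
        exact Finset.sum_congr rfl fun j _ => by ring

/-- A point at which the monomial `i₀` dominates all others together lies in the complement of the
amoeba and has order `A i₀`. -/
theorem mem_orderComponent_of_lopsided [DecidableEq ι] (A : ι → Fin n → ℤ) {b : ι → ℂ}
    {w : Fin n → ℝ} {i₀ : ι}
    (h : ∑ i ∈ Finset.univ.erase i₀, ‖scaled A b w i‖ < ‖scaled A b w i₀‖) :
    w ∈ orderComponent A b (A i₀) := by
  have hrot : ∀ θ i, ‖rotate A (scaled A b w) θ i‖ = ‖scaled A b w i‖ := fun θ i => by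
    rw [rotate, norm_mul, Complex.norm_exp_ofReal_mul_I, mul_one]
  have h' : ∀ θ, ∑ i ∈ Finset.univ.erase i₀, ‖rotate A (scaled A b w) θ i‖ <
      ‖rotate A (scaled A b w) θ i₀‖ := fun θ => by simpa only [hrot] using h
  have hw : w ∉ amoeba A b := by
    rw [notMem_amoeba_iff]
    intro θ
    -- In direction 0 at time 0 the exponential sum is the plain sum of the terms.
    have := expSum_ne_zero_of_lopsided (fun i => A i ⬝ᵥ (0 : Fin n → ℤ)) (h' θ) 0
    rw [expSum_rotate] at this
    simpa using this
  refine ⟨hw, fun j => ?_⟩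
  have h1 := sum_mul_order_eq_winding A b hw (Pi.single j 1) 0
  rw [winding_of_lopsided _ (h' 0)] at h1
  simpa [Pi.single_apply] using h1

end Order

/-! ### Moving the base point along integer directions. -/

section Perturbation

variable {n : ℕ} {ι : Type*}

theorem rotate_scaled_add (A : ι → Fin n → ℤ) (b : ι → ℂ) (w θ : Fin n → ℝ) (v : Fin n → ℤ)
    (t : ℝ) (i : ι) :
    rotate A (scaled A b (w + t • fun k => (v k : ℝ))) θ i =
      rotate A (scaled A b w) θ i * ((Real.exp t : ℝ) : ℂ) ^ (A i ⬝ᵥ v) := by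
  simp only [rotate, scaled]
  rw [pair_add, pair_smul, pair_intCast, Real.exp_add, mul_comm t]
  push_cast
  rw [← Complex.exp_int_mul]
  ring

/-- The values depend only on a point of a product of circles, which is compact, so the minimum
modulus is attained. -/
theorem exists_pos_le_norm_of_notMem_amoeba [Fintype ι] {A : ι → Fin n → ℤ} {b : ι → ℂ}
    {w : Fin n → ℝ} (hw : w ∉ amoeba A b) :
    ∃ δ > 0, ∀ θ, δ ≤ ‖∑ i, rotate A (scaled A b w) θ i‖ := by
  rw [notMem_amoeba_iff] at hw
  let F : (Fin n → Circle) → ℂ := fun u => ∑ i, scaled A b w i * ((∏ k, u k ^ A i k : Circle) : ℂ)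
  have hF : ∀ θ : Fin n → ℝ,
      F (fun k => Circle.exp (θ k)) = ∑ i, rotate A (scaled A b w) θ i := by
    intro θ
    refine Finset.sum_congr rfl fun i _ => ?_
    rw [rotate]
    congr 1
    change Circle.coeHom _ = _
    rw [map_prod, pair, Complex.ofReal_sum, Finset.sum_mul, Complex.exp_sum]
    refine Finset.prod_congr rfl fun k _ => ?_
    rw [map_zpow]
    change (Circle.exp (θ k) : ℂ) ^ A i k = _
    rw [Circle.coe_exp, ← Complex.exp_int_mul]
    push_cast
    ring_nf
  have hFc : Continuous F := by fun_prop
  obtain ⟨u, -, hu⟩ := isCompact_univ.exists_isMinOn (Set.univ_nonempty) hFc.norm.continuousOn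
  have hsurj : ∀ u : Fin n → Circle, ∃ θ : Fin n → ℝ, u = fun k => Circle.exp (θ k) :=
    fun u => ⟨fun k => Complex.arg (u k), funext fun k => (Circle.exp_arg (u k)).symm⟩
  refine ⟨‖F u‖, ?_, fun θ => ?_⟩
  · obtain ⟨θ, rfl⟩ := hsurj u
    rw [hF]; exact norm_pos_iff.2 (hw θ)
  · rw [← hF]; exact hu (Set.mem_univ _)

/-- Rounding to a fine enough grid suffices. The direction has to be integral so that the
restriction to it is a Laurent polynomial in one variable. -/
theorem exists_intCast_sub_near (w w' : Fin n → ℝ) {U : Set (Fin n → ℝ)} (hU : IsOpen U)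
    (hw' : w' ∈ U) : ∃ t : ℝ, 0 < t ∧ ∃ v : Fin n → ℤ, w - t • (fun k => (v k : ℝ)) ∈ U := by
  obtain ⟨ε, hε, hsub⟩ := Metric.isOpen_iff.1 hU w' hw'
  refine ⟨ε / 2, by positivity, fun k => ⌊(w k - w' k) / (ε / 2)⌋, hsub ?_⟩
  rw [Metric.mem_ball]
  refine lt_of_le_of_lt ((dist_pi_le_iff (half_pos hε).le).2 fun k => ?_) (half_lt_self hε)
  have h1 := Int.floor_le ((w k - w' k) / (ε / 2))
  have h2 := Int.lt_floor_add_one ((w k - w' k) / (ε / 2))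
  rw [le_div_iff₀ (half_pos hε)] at h1
  rw [div_lt_iff₀ (half_pos hε)] at h2
  rw [Real.dist_eq, abs_le]
  simp only [Pi.sub_apply, Pi.smul_apply, smul_eq_mul]
  constructor <;> linarith

end Perturbation

/-! ### A singular zero forces the last switch at `|c|`. -/

section Switch

variable {n : ℕ} {α : Fin (n + 1) → Fin n → ℤ} {y : Fin n → ℤ} {q : Fin (n + 1) → ℕ}
  {b : Fin (n + 1) → ℂ} {c : ℂ} {z : Fin n → ℂ}

/-- `∑ |bᵢ| exp ⟨α(i) - y, w⟩`. -/
noncomputable def potential (α : Fin (n + 1) → Fin n → ℤ) (y : Fin n → ℤ)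
    (b : Fin (n + 1) → ℂ) (w : Fin n → ℝ) : ℝ :=
  ∑ i, ‖b i‖ * Real.exp (pair (α i) w - pair y w)

theorem continuous_potential : Continuous (potential α y b) := by
  have := fun i => continuous_pair (α i)
  have := continuous_pair y
  unfold potential
  fun_prop

theorem sum_mul_pair (hq : ∀ k, ∑ i, (q i : ℤ) * α i k = (∑ i, (q i : ℤ)) * y k)
    (u : Fin n → ℝ) : ∑ i, (q i : ℝ) * (pair (α i) u - pair y u) = 0 := by
  have h1 : ∑ i, (q i : ℝ) * pair (α i) u = (∑ i, (q i : ℝ)) * pair y u := by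
    simp only [pair, Finset.mul_sum, ← mul_assoc]
    rw [Finset.sum_comm]
    refine Finset.sum_congr rfl fun k _ => ?_
    rw [← Finset.sum_mul]
    congr 1
    exact_mod_cast hq k
  simp only [mul_sub, Finset.sum_sub_distrib, h1, Finset.sum_mul, sub_self]

theorem monom_eq_exp (hz : ∀ k, z k ≠ 0) (a : Fin n → ℤ) :
    monom a z = Real.exp (pair a fun k => Real.log ‖z k‖) *
      Complex.exp (pair a (fun k => (z k).arg) * Complex.I) := by
  rw [← monom_exp]
  congr 1
  funext k
  rw [Real.exp_log (norm_pos_iff.2 (hz k)), Complex.norm_mul_exp_arg_mul_I]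

/-- `z` is a singular zero: the terms satisfy `p bᵢ z ^ α(i) = - qᵢ c z ^ y` with `p = ∑ qᵢ`. -/
def IsSingularZero (α : Fin (n + 1) → Fin n → ℤ) (y : Fin n → ℤ) (q : Fin (n + 1) → ℕ)
    (b : Fin (n + 1) → ℂ) (c : ℂ) (z : Fin n → ℂ) : Prop :=
  (∀ k, z k ≠ 0) ∧
    ∀ i, (∑ j, (q j : ℂ)) * (b i * monom (α i) z) = -(q i : ℂ) * (c * monom y z)

theorem norm_mul_exp_of_isSingularZero (h : IsSingularZero α y q b c z) (i : Fin (n + 1)) :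
    (∑ j, (q j : ℝ)) * (‖b i‖ * Real.exp (pair (α i) fun k => Real.log ‖z k‖)) =
      q i * (‖c‖ * Real.exp (pair y fun k => Real.log ‖z k‖)) := by
  have h1 := congrArg norm (h.2 i)
  rw [monom_eq_exp h.1, monom_eq_exp h.1] at h1
  have hp : (∑ j, (q j : ℂ)) = ((∑ j, q j : ℕ) : ℂ) := by push_cast; rfl
  rw [hp] at h1
  simp only [norm_mul, norm_neg, Complex.norm_natCast, Complex.norm_exp_ofReal_mul_I, mul_one,
    Complex.norm_real, Real.norm_eq_abs, Real.abs_exp] at h1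
  push_cast at h1
  exact h1

theorem sum_pos_of_pos (hq0 : ∀ i, 0 < q i) : 0 < ∑ j, (q j : ℝ) :=
  Finset.sum_pos (fun i _ => Nat.cast_pos.2 (hq0 i)) Finset.univ_nonempty

theorem norm_mul_exp_sub_of_isSingularZero (hq0 : ∀ i, 0 < q i) (h : IsSingularZero α y q b c z)
    (i : Fin (n + 1)) :
    ‖b i‖ * Real.exp ((pair (α i) fun k => Real.log ‖z k‖) - pair y fun k => Real.log ‖z k‖) =
      q i / (∑ j, (q j : ℝ)) * ‖c‖ := by
  have h1 := norm_mul_exp_of_isSingularZero h i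
  have hp := (sum_pos_of_pos hq0).ne'
  have he := (Real.exp_pos (pair y fun k => Real.log ‖z k‖)).ne'
  rw [Real.exp_sub]
  field_simp
  linarith

theorem potential_eq_of_isSingularZero (hq0 : ∀ i, 0 < q i) (h : IsSingularZero α y q b c z) :
    potential α y b (fun k => Real.log ‖z k‖) = ‖c‖ := by
  simp only [potential, norm_mul_exp_sub_of_isSingularZero hq0 h]
  rw [← Finset.sum_mul, ← Finset.sum_div, div_self (sum_pos_of_pos hq0).ne', one_mul]

/-- Apply `exp u ≥ 1 + u` to each term around `log |z|`. The terms there are in proportion to the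
weights, so the linear parts cancel by the barycentric relation. -/
theorem norm_le_potential (hq0 : ∀ i, 0 < q i)
    (hq : ∀ k, ∑ i, (q i : ℤ) * α i k = (∑ i, (q i : ℤ)) * y k)
    (h : IsSingularZero α y q b c z) (w : Fin n → ℝ) : ‖c‖ ≤ potential α y b w := by
  set w₀ : Fin n → ℝ := fun k => Real.log ‖z k‖ with hw₀
  have hp := sum_pos_of_pos hq0
  have hs := sum_mul_pair hq (w - w₀)
  have hpt : ∀ a : Fin n → ℤ, pair a w = pair a w₀ + pair a (w - w₀) := fun a => by
    rw [← pair_add, add_sub_cancel]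
  calc ‖c‖ = ∑ i, q i / (∑ j, (q j : ℝ)) * ‖c‖ *
        (pair (α i) (w - w₀) - pair y (w - w₀) + 1) := by
        have : ∀ i, q i / (∑ j, (q j : ℝ)) * ‖c‖ * (pair (α i) (w - w₀) - pair y (w - w₀) + 1) =
            ‖c‖ / (∑ j, (q j : ℝ)) * (q i * (pair (α i) (w - w₀) - pair y (w - w₀))) +
            ‖c‖ / (∑ j, (q j : ℝ)) * q i := fun i => by ring
        simp only [this]
        rw [Finset.sum_add_distrib, ← Finset.mul_sum, ← Finset.mul_sum, hs]
        field_simp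
        ring
    _ ≤ potential α y b w := by
        refine Finset.sum_le_sum fun i _ => ?_
        rw [hpt (α i), hpt y, add_sub_add_comm, Real.exp_add, ← mul_assoc,
          norm_mul_exp_sub_of_isSingularZero hq0 h]
        exact mul_le_mul_of_nonneg_left (Real.add_one_le_exp _) (by positivity)

theorem phase_of_isSingularZero (hc : c ≠ 0) (hq0 : ∀ i, 0 < q i)
    (h : IsSingularZero α y q b c z) (i : Fin (n + 1)) :
    b i * Complex.exp (pair (α i) (fun k => (z k).arg) * Complex.I) =
      -(‖b i‖ * (Complex.exp (c.arg * Complex.I) *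
        Complex.exp (pair y (fun k => (z k).arg) * Complex.I))) := by
  have h1 := h.2 i
  have h2 := congrArg (fun x : ℝ => (x : ℂ)) (norm_mul_exp_of_isSingularZero h i)
  rw [monom_eq_exp h.1, monom_eq_exp h.1] at h1
  push_cast at h1 h2
  have h3 : c = ‖c‖ * Complex.exp (c.arg * Complex.I) := (Complex.norm_mul_exp_arg_mul_I c).symm
  have hc' : (‖c‖ : ℂ) ≠ 0 := by exact_mod_cast norm_ne_zero_iff.2 hc
  have hqi : (q i : ℂ) ≠ 0 := by exact_mod_cast (hq0 i).ne'
  have he := Complex.exp_ne_zero (pair y fun k => Real.log ‖z k‖ : ℝ)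
  generalize Complex.exp (c.arg * Complex.I) = u at *
  refine mul_left_cancel₀ (mul_ne_zero (mul_ne_zero hqi hc') he) ?_
  rw [h3] at h1
  linear_combination ‖b i‖ * h1 -
    b i * Complex.exp (pair (α i) (fun k => (z k).arg) * Complex.I) * h2

/-- At the arguments of `z` all terms with coefficients `b i` point opposite to the term of `y`, so
only a real quantity remains; it vanishes exactly where the potential equals `κ`. -/
theorem sum_rotate_family (hc : c ≠ 0) (hq0 : ∀ i, 0 < q i) (h : IsSingularZero α y q b c z)
    (κ : ℝ) (w : Fin n → ℝ) :
    ∑ i, rotate (exponents α y) (scaled (exponents α y) (family b c κ) w)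
        (fun k => (z k).arg) i =
      Complex.exp (c.arg * Complex.I) * Complex.exp (pair y (fun k => (z k).arg) * Complex.I) *
        (Real.exp (pair y w) * (κ - potential α y b w) : ℝ) := by
  rw [Fintype.sum_option]
  simp only [rotate, scaled, family, coeffs, exponents, Option.elim]
  have h1 : ∀ i, b i * (Real.exp (pair (α i) w) : ℂ) *
      Complex.exp (pair (α i) (fun k => (z k).arg) * Complex.I) =
      -(Complex.exp (c.arg * Complex.I) * Complex.exp (pair y (fun k => (z k).arg) * Complex.I) *
        (Real.exp (pair y w) * (‖b i‖ * Real.exp (pair (α i) w - pair y w)) : ℝ)) := by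
    intro i
    rw [mul_right_comm, phase_of_isSingularZero hc hq0 h, Real.exp_sub,
      mul_div_assoc', mul_div_cancel₀ _ (Real.exp_pos (pair y w)).ne']
    push_cast
    ring
  simp only [h1]
  rw [Finset.sum_neg_distrib, ← Finset.mul_sum, ← Complex.ofReal_sum, ← Finset.mul_sum,
    ← potential]
  push_cast
  ring

theorem lopsided_of_potential_lt {κ : ℝ} {w : Fin n → ℝ} (hκ : potential α y b w < κ) :
    ∑ i ∈ Finset.univ.erase none, ‖scaled (exponents α y) (family b c κ) w i‖ <
      ‖scaled (exponents α y) (family b c κ) w none‖ := by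
  have h0 : 0 ≤ potential α y b w := Finset.sum_nonneg fun i _ => by positivity
  rw [Finset.sum_erase_eq_sub (Finset.mem_univ _), Fintype.sum_option, add_sub_cancel_left]
  simp only [scaled, family, coeffs, exponents, Option.elim, norm_mul, Complex.norm_real,
    Real.norm_eq_abs, Real.abs_exp, Complex.norm_exp_ofReal_mul_I, mul_one,
    abs_of_pos (h0.trans_lt hκ)]
  have h1 : potential α y b w * Real.exp (pair y w) =
      ∑ i, ‖b i‖ * Real.exp (pair (α i) w) := by
    rw [potential, Finset.sum_mul]
    refine Finset.sum_congr rfl fun i _ => ?_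
    rw [mul_assoc, ← Real.exp_add, sub_add_cancel]
  rw [← h1]
  exact mul_lt_mul_of_pos_right hκ (Real.exp_pos _)

theorem mem_orderComponent_of_potential_lt {κ : ℝ} {w : Fin n → ℝ}
    (hκ : potential α y b w < κ) :
    w ∈ orderComponent (exponents α y) (family b c κ) y :=
  mem_orderComponent_of_lopsided (exponents α y) (i₀ := none) (lopsided_of_potential_lt hκ)

/-- A point of order `y` is joined by an integer direction to a point where `y` dominates. Equal
winding numbers at both ends exclude zeros in between, while the potential must cross the level `κ`
there. -/
theorem orderComponent_eq_empty (hc : c ≠ 0) (hq0 : ∀ i, 0 < q i)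
    (hq : ∀ k, ∑ i, (q i : ℤ) * α i k = (∑ i, (q i : ℤ)) * y k)
    (h : IsSingularZero α y q b c z) :
    orderComponent (exponents α y) (family b c ‖c‖) y = ∅ := by
  rw [Set.eq_empty_iff_forall_notMem]
  rintro w ⟨hw, hord⟩
  set A := exponents α y with hA
  set φ : Fin n → ℝ := fun k => (z k).arg with hφ
  have hlt : ‖c‖ < potential α y b w := by
    refine lt_of_le_of_ne (norm_le_potential hq0 hq h w) fun heq => ?_
    refine (notMem_amoeba_iff _ _ _).1 hw φ ?_
    rw [sum_rotate_family hc hq0 h, ← heq, sub_self, mul_zero, Complex.ofReal_zero, mul_zero]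
  obtain ⟨δ, hδ, hδw⟩ := exists_pos_le_norm_of_notMem_amoeba hw
  -- The first bound keeps `κ` below the potential at `w`; the second keeps the change of the
  -- polynomial on the torus over `w` below its minimum modulus bound `δ`.
  obtain ⟨κ, hκ1, hκ2⟩ := exists_between (lt_min hlt
    (lt_add_of_pos_right ‖c‖ (div_pos hδ (Real.exp_pos (pair y w)))))
  obtain ⟨hκ3, hκ4⟩ := lt_min_iff.1 hκ2
  have hκ5 : (κ - ‖c‖) * Real.exp (pair y w) < δ := by
    rw [← lt_div_iff₀ (Real.exp_pos _)]; linarith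
  obtain ⟨t, ht, v, hv⟩ := exists_intCast_sub_near w (fun k => Real.log ‖z k‖)
    (isOpen_lt (continuous_potential (α := α) (y := y) (b := b)) (continuous_const (y := κ)))
    ((potential_eq_of_isSingularZero hq0 h).trans_lt hκ1)
  set w₁ := w - t • (fun k => (v k : ℝ)) with hw₁
  have hw1 : w = w₁ + t • fun k => (v k : ℝ) := by rw [hw₁, sub_add_cancel]
  have hv' : potential α y b w₁ < κ := hv
  -- the winding number along `v` does not change as the parameter increases from `|c|` to `κ`
  let a : unitInterval → Option (Fin (n + 1)) → ℂ := fun σ =>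
    rotate A (scaled A (family b c (‖c‖ + σ * (κ - ‖c‖))) w) φ
  have ha : Continuous a := by
    refine continuous_pi fun i => ?_
    cases i <;> simp only [a, rotate, scaled, family, coeffs, Option.elim] <;> fun_prop
  have hsum : ∀ (σ : unitInterval) θ,
      ∑ i, rotate A (scaled A (family b c (‖c‖ + σ * (κ - ‖c‖))) w) θ i ≠ 0 := by
    intro σ θ h0
    have e : ∑ i, rotate A (scaled A (family b c ‖c‖) w) θ i =
        -(((σ : ℝ) * (κ - ‖c‖) * Real.exp (pair y w) : ℝ) *
          (Complex.exp (c.arg * Complex.I) * Complex.exp (pair y θ * Complex.I))) := by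
      rw [eq_neg_iff_add_eq_zero, ← h0, Fintype.sum_option, Fintype.sum_option]
      simp only [rotate, scaled, family, coeffs, hA, exponents, Option.elim]
      push_cast
      ring
    have h1 := hδw θ
    rw [e, norm_neg, norm_mul, norm_mul, Complex.norm_exp_ofReal_mul_I,
      Complex.norm_exp_ofReal_mul_I, mul_one, mul_one, Complex.norm_real, Real.norm_of_nonneg
        (mul_nonneg (mul_nonneg σ.2.1 (by linarith)) (Real.exp_pos _).le), mul_assoc] at h1
    have h2 : (σ : ℝ) * ((κ - ‖c‖) * Real.exp (pair y w)) ≤ (κ - ‖c‖) * Real.exp (pair y w) :=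
      mul_le_of_le_one_left (mul_nonneg (by linarith) (Real.exp_pos _).le) σ.2.2
    linarith
  have hane : ∀ σ s, expSum (fun i => A i ⬝ᵥ v) (a σ) s ≠ 0 := fun σ s => by
    rw [expSum_rotate]; exact hsum σ _
  have ha0 : a 0 = rotate A (scaled A (family b c ‖c‖) w) φ := by simp [a]
  have ha1 : a 1 = rotate A (scaled A (family b c κ) w) φ := by simp [a]
  have hwind : winding (fun i => A i ⬝ᵥ v) (a 1) = ((y ⬝ᵥ v : ℤ) : ℂ) := by
    rw [winding_eq_winding ha hane 1 0, ha0, ← sum_mul_order_eq_winding A _ hw v φ]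
    simp only [hord, dotProduct]
    push_cast
    exact Finset.sum_congr rfl fun j _ => mul_comm _ _
  -- the winding number at the lopsided point `w₁`
  set a₁ := rotate A (scaled A (family b c κ) w₁) φ with ha₁
  have hnorm : ∀ i, ‖a₁ i‖ = ‖scaled A (family b c κ) w₁ i‖ := fun i => by
    rw [ha₁, rotate, norm_mul, Complex.norm_exp_ofReal_mul_I, mul_one]
  have hlop : ∑ i ∈ Finset.univ.erase none, ‖a₁ i‖ < ‖a₁ none‖ := by
    simp only [hnorm]; exact lopsided_of_potential_lt hv'
  -- In the variable along `v`, radius 1 corresponds to `w₁` and radius `exp t` to `w`.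
  have e1 : (fun i => a₁ i * ((1 : ℝ) : ℂ) ^ (A i ⬝ᵥ v)) = a₁ := by funext i; simp
  have e2 : (fun i => a₁ i * ((Real.exp t : ℝ) : ℂ) ^ (A i ⬝ᵥ v)) = a 1 := by
    rw [ha1, hw1]; funext i; rw [rotate_scaled_add]
  -- a zero between the two radii
  let g : ℝ → ℝ := fun τ => potential α y b (w₁ + τ • fun k => (v k : ℝ))
  have hg : Continuous g := continuous_potential.comp (by fun_prop)
  have hκ : κ ∈ Set.Ioo (g 0) (g t) := by
    refine ⟨by simpa [g] using hv', ?_⟩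
    simp only [g]
    rwa [← hw1]
  obtain ⟨τ, hτ, hgτ⟩ := intermediate_value_Ioo ht.le hg.continuousOn hκ
  have hnτ : ‖((Real.exp τ : ℝ) : ℂ)‖ = Real.exp τ := by
    rw [Complex.norm_real, Real.norm_of_nonneg (Real.exp_pos _).le]
  refine ne_zero_of_winding_eq (m := fun i => A i ⬝ᵥ v) (a := a₁) (r₁ := 1) (r₂ := Real.exp t)
    one_pos ?_ ?_ ?_ (z := ((Real.exp τ : ℝ) : ℂ)) ?_ ?_ ?_
  · rw [e1]; exact expSum_ne_zero_of_lopsided _ hlop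
  · rw [e2]; exact hane 1
  · rw [e1, e2, hwind, winding_of_lopsided _ hlop]; rfl
  · rw [hnτ]; exact Real.one_lt_exp_iff.2 hτ.1
  · rw [hnτ]; exact Real.exp_lt_exp.2 hτ.2
  · simp only [ha₁, ← rotate_scaled_add]
    rw [sum_rotate_family hc hq0 h]
    have : potential α y b (w₁ + τ • fun k => (v k : ℝ)) = κ := hgτ
    rw [this, sub_self, mul_zero, Complex.ofReal_zero, mul_zero]

/-- For every parameter beyond `|c|` the point `log |z|` has order `y`, so no later switch can
occur. -/
theorem switchesLastAt_of_isSingularZero (hc : c ≠ 0) (hq0 : ∀ i, 0 < q i)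
    (hq : ∀ k, ∑ i, (q i : ℤ) * α i k = (∑ i, (q i : ℤ)) * y k)
    (h : IsSingularZero α y q b c z) : SwitchesLastAt α y b c ‖c‖ := by
  have hne : ∀ κ, ‖c‖ < κ →
      (orderComponent (exponents α y) (family b c κ) y).Nonempty := fun κ hκ =>
    ⟨_, mem_orderComponent_of_potential_lt
      ((potential_eq_of_isSingularZero hq0 h).trans_lt hκ)⟩
  refine ⟨⟨norm_nonneg c, orderComponent_eq_empty hc hq0 hq h, 1, one_pos,
    fun ε hε _ => hne _ (lt_add_of_pos_right _ hε)⟩, fun κ hκ => ?_⟩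
  by_contra hlt
  exact (hne κ (not_le.1 hlt)).ne_empty hκ.2.1

end Switch

/-! ### Barycentric weights, and elimination of the singular point. -/

section Lattice

open scoped Matrix

variable {n : ℕ} {α : Fin (n + 1) → Fin n → ℤ} {y : Fin n → ℤ} {q : Fin (n + 1) → ℕ}

/-- The integer matrix with columns `α(1), …, α(n)`. -/
def intMat (α : Fin (n + 1) → Fin n → ℤ) : Matrix (Fin n) (Fin n) ℤ :=
  Matrix.of fun i j => α j.succ i

theorem matM_eq_map (α : Fin (n + 1) → Fin n → ℤ) :
    matM α = (intMat α).map (Int.castRingHom ℝ) := rfl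

theorem det_matM (α : Fin (n + 1) → Fin n → ℤ) : (matM α).det = ((intMat α).det : ℝ) := by
  rw [matM_eq_map, ← RingHom.mapMatrix_apply, ← RingHom.map_det]; rfl

theorem det_intMat_ne_zero (hα0 : α 0 = 0)
    (hsimplex : AffineIndependent ℝ fun (i : Fin (n + 1)) (k : Fin n) => (α i k : ℝ)) :
    (intMat α).det ≠ 0 := by
  rw [affineIndependent_iff_linearIndependent_vsub ℝ _ 0] at hsimplex
  have h1 := hsimplex.comp
    (fun j : Fin n => (⟨j.succ, Fin.succ_ne_zero j⟩ : {x : Fin (n + 1) // x ≠ 0}))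
    (fun i j h => Fin.succ_injective n (congrArg Subtype.val h))
  have h2 : LinearIndependent ℝ (matM α).col := by
    have e : (matM α).col = (fun i : {x : Fin (n + 1) // x ≠ 0} =>
        (fun k => (α i k : ℝ)) -ᵥ (fun k : Fin n => (α 0 k : ℝ))) ∘
        fun j : Fin n => ⟨j.succ, Fin.succ_ne_zero j⟩ := by
      funext j k
      simp [hα0, matM, Matrix.col]
    rw [e]
    exact h1
  have h3 := ((Matrix.isUnit_iff_isUnit_det _).1
    (Matrix.linearIndependent_cols_iff_isUnit.1 h2)).ne_zero
  rw [det_matM] at h3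
  exact_mod_cast h3

/-- The barycentric weights of `y`, as coprime positive integers. -/
structure IsWeights (α : Fin (n + 1) → Fin n → ℤ) (y : Fin n → ℤ) (q : Fin (n + 1) → ℕ) :
    Prop where
  zero : α 0 = 0
  det_ne_zero : (intMat α).det ≠ 0
  pos : ∀ i, 0 < q i
  gcd : Finset.univ.gcd q = 1
  rel : ∀ k, ∑ i, (q i : ℤ) * α i k = (∑ i, (q i : ℤ)) * y k

/-- By Cramer's rule `|det M|` clears the denominators of the barycentric coordinates, which are
positive at interior points; then divide by the gcd. -/
theorem exists_isWeights (hα0 : α 0 = 0)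
    (hsimplex : AffineIndependent ℝ fun (i : Fin (n + 1)) (k : Fin n) => (α i k : ℝ))
    (hy : (fun k => (y k : ℝ)) ∈ interior (convexHull ℝ
      (Set.range fun (i : Fin (n + 1)) (k : Fin n) => (α i k : ℝ)))) :
    ∃ q, IsWeights α y q := by
  have hdet := det_intMat_ne_zero hα0 hsimplex
  let B : AffineBasis (Fin (n + 1)) ℝ (Fin n → ℝ) := ⟨_, hsimplex,
    hsimplex.affineSpan_eq_top_iff_card_eq_finrank_add_one.2 (by simp)⟩
  have hBrange : (Set.range fun (i : Fin (n + 1)) (k : Fin n) => (α i k : ℝ)) = Set.range B := rfl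
  rw [hBrange, AffineBasis.interior_convexHull] at hy
  set Y : Fin n → ℝ := fun k => (y k : ℝ) with hY
  set l : Fin (n + 1) → ℝ := fun i => B.coord i Y with hl
  have hpos : ∀ i, 0 < l i := hy
  have hsum : ∑ i, l i = 1 := B.sum_coord_apply_eq_one Y
  have hcomb : ∀ k, ∑ i, l i * α i k = y k := by
    intro k
    have := congrFun (B.linear_combination_coord_eq_self Y) k
    simp only [Finset.sum_apply, Pi.smul_apply, smul_eq_mul] at this
    exact this
  have hdetR : (0 : ℝ) < |((intMat α).det : ℝ)| := abs_pos.2 (by exact_mod_cast hdet)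
  have hmul : matM α *ᵥ (fun j => l j.succ) = Y := by
    funext k
    rw [hY]
    simp only [Matrix.mulVec, dotProduct]
    rw [← hcomb k, Fin.sum_univ_succ]
    simp [hα0, matM, mul_comm]
  have hcr : ∀ j : Fin n, ((intMat α).det : ℝ) * l j.succ =
      (((intMat α).adjugate *ᵥ y) j : ℤ) := by
    intro j
    have h1 := congrArg (fun v => ((matM α).adjugate *ᵥ v) j) hmul
    simp only [Matrix.mulVec_mulVec, Matrix.adjugate_mul, Matrix.smul_mulVec, Matrix.one_mulVec,
      Pi.smul_apply, smul_eq_mul] at h1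
    rw [det_matM] at h1
    rw [h1, matM_eq_map, ← RingHom.mapMatrix_apply, ← RingHom.map_adjugate]
    simp [Matrix.mulVec, dotProduct, hY]
  have hint : ∀ i, ∃ r : ℤ, (r : ℝ) = |((intMat α).det : ℝ)| * l i := by
    have h1 : ∀ j : Fin n, ∃ r : ℤ, (r : ℝ) = |((intMat α).det : ℝ)| * l j.succ := fun j =>
      ⟨|((intMat α).adjugate *ᵥ y) j|, by
        rw [Int.cast_abs, ← hcr, abs_mul, abs_of_pos (hpos _)]⟩
    refine Fin.cases ?_ h1
    choose r hr using h1
    refine ⟨|(intMat α).det| - ∑ j, r j, ?_⟩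
    rw [Fin.sum_univ_succ] at hsum
    rw [Int.cast_sub, Int.cast_abs, Int.cast_sum]
    simp only [hr, ← Finset.mul_sum]
    linear_combination -|((intMat α).det : ℝ)| * hsum
  choose r hr using hint
  have hrpos : ∀ i, 0 < r i := fun i => by
    have : (0 : ℝ) < r i := by rw [hr]; exact mul_pos hdetR (hpos i)
    exact_mod_cast this
  have hrn : ∀ i, (((r i).toNat : ℕ) : ℝ) = r i := fun i => by
    rw [← Int.cast_natCast, Int.toNat_of_nonneg (hrpos i).le]
  obtain ⟨q, hq1, hq2⟩ := Finset.extract_gcd (fun i => (r i).toNat)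
    (Finset.univ_nonempty (α := Fin (n + 1)))
  set G := Finset.univ.gcd fun i => (r i).toNat with hG
  have hqr : ∀ i, (G : ℝ) * q i = |((intMat α).det : ℝ)| * l i := fun i => by
    rw [← hr, ← hrn, hq1 i (Finset.mem_univ i)]; push_cast; rfl
  have hG0 : (G : ℝ) ≠ 0 := fun h0 => by
    have := hqr 0
    rw [h0, zero_mul] at this
    exact (mul_pos hdetR (hpos 0)).ne this
  refine ⟨q, hα0, hdet, fun i => ?_, hq2, fun k => ?_⟩
  · refine Nat.pos_of_ne_zero fun h0 => ?_
    have := hqr i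
    rw [h0, Nat.cast_zero, mul_zero] at this
    exact (mul_pos hdetR (hpos i)).ne this
  · have h1 : (∑ i, (q i : ℝ) * α i k) = (∑ i, (q i : ℝ)) * y k := by
      refine mul_left_cancel₀ hG0 ?_
      rw [← mul_assoc, Finset.mul_sum, Finset.mul_sum]
      simp only [← mul_assoc, hqr]
      simp only [mul_assoc]
      rw [← Finset.mul_sum, ← Finset.mul_sum, hcomb, hsum]
      ring
    exact_mod_cast h1

theorem prod_zpow_eq_zpow_sum {ι K : Type*} [Field K] (s : Finset ι) (f : ι → ℤ)
    {x : K} (hx : x ≠ 0) : ∏ i ∈ s, x ^ f i = x ^ ∑ i ∈ s, f i := by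
  classical
  induction s using Finset.induction_on with
  | empty => simp
  | insert i s hi ih => rw [Finset.prod_insert hi, Finset.sum_insert hi, ih, zpow_add₀ hx]

namespace IsWeights

theorem sum_pos (hq : IsWeights α y q) : 0 < ∑ i, q i :=
  Finset.sum_pos (fun i _ => hq.pos i) Finset.univ_nonempty

theorem det_map_ne_zero {K : Type*} [Field K] [CharZero K] (hq : IsWeights α y q) :
    ((intMat α).map (Int.castRingHom K)).det ≠ 0 := by
  rw [← RingHom.mapMatrix_apply, ← RingHom.map_det]
  simpa using hq.det_ne_zero

theorem rel_cast {K : Type*} [CommRing K] (hq : IsWeights α y q) (k : Fin n) :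
    ∑ i, (q i : K) * α i k = (∑ i, (q i : K)) * y k := by
  have := congrArg (Int.cast : ℤ → K) (hq.rel k)
  push_cast at this
  exact this

/-- Affine relations among `α(0), …, α(n), y` are proportional to the barycentric one. -/
theorem eq_of_relation {K : Type*} [Field K] [CharZero K] (hq : IsWeights α y q)
    {u : Fin (n + 1) → K} {v : K} (hsum : ∑ i, u i + v = 0)
    (hlin : ∀ k, ∑ i, u i * α i k + v * y k = 0) (i : Fin (n + 1)) :
    (∑ j, (q j : K)) * u i = -(q i : K) * v := by
  -- Adding `v` times the barycentric relation removes `y`. What remains is an affine relation among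
  -- the vertices, which must be trivial.
  set t : Fin (n + 1) → K := fun i => (∑ j, (q j : K)) * u i + q i * v with ht
  have h1 : ∀ k, ∑ i, t i * α i k = 0 := by
    intro k
    have h2 : ∀ i, t i * α i k = (∑ j, (q j : K)) * (u i * α i k) + v * (q i * α i k) :=
      fun i => by rw [ht]; ring
    simp only [h2]
    rw [Finset.sum_add_distrib, ← Finset.mul_sum, ← Finset.mul_sum, hq.rel_cast]
    linear_combination (∑ j, (q j : K)) * hlin k
  have h3 : (fun j : Fin n => t j.succ) = 0 := by
    refine Matrix.eq_zero_of_mulVec_eq_zero (hq.det_map_ne_zero (K := K)) ?_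
    funext k
    have := h1 k
    rw [Fin.sum_univ_succ] at this
    simpa [hq.zero, Matrix.mulVec, dotProduct, intMat, mul_comm] using this
  have h4 : ∑ i, t i = 0 := by
    simp only [ht]
    rw [Finset.sum_add_distrib, ← Finset.mul_sum, ← Finset.sum_mul]
    linear_combination (∑ j, (q j : K)) * hsum
  have h5 : ∀ i, t i = 0 := by
    refine Fin.cases ?_ fun j => congrFun h3 j
    rw [Fin.sum_univ_succ] at h4
    simpa [congrFun h3] using h4
  have := h5 i
  simp only [ht] at this
  linear_combination this

/-- With the derivatives `z_k ∂_k`, a singular zero says precisely that the terms of `f` at `z` are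
the coefficients of an affine relation, hence proportional to the weights. -/
theorem mem_nablaZero_iff (hq : IsWeights α y q) (v : Option (Fin (n + 1)) → ℂ) :
    v ∈ nablaZero (exponents α y) ↔
      (∀ i, v i ≠ 0) ∧ ∃ z, IsSingularZero α y q (fun i => v (some i)) (v none) z := by
  refine and_congr_right fun _ => exists_congr fun z => ?_
  rw [IsSingularZero, and_congr_right_iff]
  intro hz
  have hl : laurent (exponents α y) v z =
      ∑ i, v (some i) * monom (α i) z + v none * monom y z := by
    rw [laurent, Fintype.sum_option, add_comm]; rfl
  have hd : ∀ k, z k * partialDeriv (laurent (exponents α y) v) k z =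
      ∑ i, v (some i) * monom (α i) z * α i k + v none * monom y z * y k := by
    intro k
    rw [mul_partialDeriv_laurent _ _ _ (hz k), Fintype.sum_option, add_comm, mul_comm (_ : ℂ)]
    congr 1
    exact Finset.sum_congr rfl fun i _ => mul_comm _ _
  have hd' : (∀ k, partialDeriv (laurent (exponents α y) v) k z = 0) ↔
      ∀ k, ∑ i, v (some i) * monom (α i) z * α i k + v none * monom y z * y k = 0 :=
    forall_congr' fun k => by rw [← hd, mul_eq_zero, or_iff_right (hz k)]
  rw [hl, hd']
  constructor
  · rintro ⟨h1, h2⟩ i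
    exact hq.eq_of_relation h1 h2 i
  · intro h
    have hp : (∑ j, (q j : ℂ)) ≠ 0 := by exact_mod_cast hq.sum_pos.ne'
    refine ⟨mul_left_cancel₀ hp ?_, fun k => mul_left_cancel₀ hp ?_⟩
    · rw [mul_add, Finset.mul_sum, Finset.sum_congr rfl fun i _ => h i]
      simp only [neg_mul]
      rw [Finset.sum_neg_distrib, ← Finset.sum_mul]
      ring
    · rw [mul_add, Finset.mul_sum]
      simp only [← mul_assoc (∑ j, (q j : ℂ))]
      rw [Finset.sum_congr rfl fun i _ => by
        rw [mul_assoc (∑ j, (q j : ℂ)), h i]]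
      have := hq.rel_cast (K := ℂ) k
      have e : ∀ i, -(q i : ℂ) * (v none * monom y z) * α i k =
          -(v none * monom y z) * (q i * α i k) := fun i => by ring
      simp only [e]
      rw [← Finset.mul_sum, this]
      ring

theorem prod_monom_pow (hq : IsWeights α y q) {z : Fin n → ℂ} (hz : ∀ k, z k ≠ 0) :
    ∏ i, monom (α i) z ^ q i = monom y z ^ ∑ i, q i := by
  simp only [monom, ← Finset.prod_pow]
  rw [Finset.prod_comm]
  refine Finset.prod_congr rfl fun k _ => ?_
  simp only [← zpow_natCast, ← zpow_mul]
  rw [prod_zpow_eq_zpow_sum _ _ (hz k)]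
  congr 1
  have := hq.rel k
  push_cast
  rw [mul_comm (y k), ← this]
  exact Finset.sum_congr rfl fun i _ => mul_comm _ _

theorem exists_bezout (hq : IsWeights α y q) : ∃ k : Fin (n + 1) → ℤ, ∑ i, q i * k i = 1 := by
  obtain ⟨d, hd⟩ := (IsPrincipalIdealRing.principal
    (Ideal.span (Set.range fun i => (q i : ℤ)))).principal
  have h1 : ∀ i, d.natAbs ∣ q i := fun i => by
    have : (q i : ℤ) ∈ Ideal.span (Set.range fun i => (q i : ℤ)) :=
      Ideal.subset_span ⟨i, rfl⟩
    rw [hd] at this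
    exact Int.natAbs_dvd_natAbs.2 (Ideal.mem_span_singleton.1 this)
  have h2 : d.natAbs ∣ 1 := hq.gcd ▸ Finset.dvd_gcd fun i _ => h1 i
  have h3 : (1 : ℤ) ∈ Ideal.span (Set.range fun i => (q i : ℤ)) := by
    rw [hd]
    exact Ideal.mem_span_singleton.2 (Int.natAbs_dvd_natAbs.1 (by simpa using h2))
  obtain ⟨k, hk⟩ := Ideal.mem_span_range_iff_exists_fun.1 h3
  exact ⟨k, by simpa [mul_comm] using hk⟩

/-- Multiplying the `q i`-th powers of the equations cancels `z`. Conversely `z ^ (α(i) - y)` is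
prescribed for each `i`; taking logarithms makes this a linear system, solvable once the branches
satisfy the barycentric relation exactly. -/
theorem exists_isSingularZero_iff (hq : IsWeights α y q) {b : Fin (n + 1) → ℂ} {c : ℂ}
    (hb : ∀ i, b i ≠ 0) (hc : c ≠ 0) :
    (∃ z, IsSingularZero α y q b c z) ↔
      ((∑ i, q i : ℕ) : ℂ) ^ (∑ i, q i) * ∏ i, b i ^ q i =
        (-1) ^ (∑ i, q i) * (∏ i, (q i : ℂ) ^ q i) * c ^ ∑ i, q i := by
  have hp : ((∑ i, q i : ℕ) : ℂ) ≠ 0 := by exact_mod_cast hq.sum_pos.ne'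
  constructor
  · rintro ⟨z, hz, h⟩
    have h1 : ∏ i, ((∑ j, (q j : ℂ)) * (b i * monom (α i) z)) ^ q i =
        ∏ i, (-(q i : ℂ) * (c * monom y z)) ^ q i :=
      Finset.prod_congr rfl fun i _ => by rw [h i]
    have e1 : ∀ i, -(q i : ℂ) * (c * monom y z) = (-1) * q i * (c * monom y z) := fun i => by ring
    simp only [e1, mul_pow, Finset.prod_mul_distrib, Finset.prod_pow_eq_pow_sum,
      hq.prod_monom_pow hz] at h1
    have hm : monom y z ^ (∑ i, q i) ≠ 0 :=
      pow_ne_zero _ (Finset.prod_ne_zero_iff.2 fun k _ => zpow_ne_zero _ (hz k))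
    refine mul_right_cancel₀ hm ?_
    push_cast
    linear_combination h1
  · intro h
    set ρ : Fin (n + 1) → ℂ := fun i => -(q i : ℂ) * c / ((∑ j, q j : ℕ) * b i) with hρ
    have hqi : ∀ i, (q i : ℂ) ≠ 0 := fun i => by exact_mod_cast (hq.pos i).ne'
    have hρ0 : ∀ i, ρ i ≠ 0 := fun i =>
      div_ne_zero (mul_ne_zero (neg_ne_zero.2 (hqi i)) hc) (mul_ne_zero hp (hb i))
    have hprod : ∏ i, ρ i ^ q i = 1 := by
      have e1 : ∀ i, ρ i = (-1) * q i * c / ((∑ j, q j : ℕ) * b i) := fun i => by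
        rw [hρ]; ring
      simp only [e1, div_pow, Finset.prod_div_distrib]
      simp only [mul_pow, Finset.prod_mul_distrib, Finset.prod_pow_eq_pow_sum]
      rw [← h, div_self]
      exact mul_ne_zero (pow_ne_zero _ hp)
        (Finset.prod_ne_zero_iff.2 fun i _ => pow_ne_zero _ (hb i))
    have hexp : Complex.exp (∑ i, q i * Complex.log (ρ i)) = 1 := by
      rw [Complex.exp_sum, ← hprod]
      refine Finset.prod_congr rfl fun i _ => ?_
      rw [Complex.exp_nat_mul, Complex.exp_log (hρ0 i)]
    obtain ⟨N, hN⟩ := Complex.exp_eq_one_iff.1 hexp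
    obtain ⟨k, hk⟩ := hq.exists_bezout
    -- The weighted sum of principal logarithms is `2πi N`; a Bézout combination of the coprime
    -- weights distributes the correction over the branches.
    set ℓ : Fin (n + 1) → ℂ :=
      fun i => Complex.log (ρ i) - (N * k i : ℤ) * (2 * Real.pi * Complex.I) with hℓ
    have hℓexp : ∀ i, Complex.exp (ℓ i) = ρ i := fun i => by
      rw [hℓ]
      simp only [Complex.exp_sub]
      rw [Complex.exp_int_mul_two_pi_mul_I, div_one, Complex.exp_log (hρ0 i)]
    have hℓsum : ∑ i, q i * ℓ i = 0 := by
      have hk' : ∑ i, (q i : ℂ) * k i = 1 := by exact_mod_cast congrArg (Int.cast : ℤ → ℂ) hk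
      have e : ∀ i, (q i : ℂ) * ℓ i = q i * Complex.log (ρ i) -
          N * (2 * Real.pi * Complex.I) * (q i * k i) := fun i => by
        rw [hℓ]; push_cast; ring
      simp only [e]
      rw [Finset.sum_sub_distrib, ← Finset.mul_sum, hN, hk']
      ring
    set T := ((intMat α).map (Int.castRingHom ℂ))ᵀ with hT
    have hTdet : IsUnit T.det := by
      rw [hT, Matrix.det_transpose]; exact hq.det_map_ne_zero.isUnit
    -- Solve for the quotients by the vertex `α(0) = 0`; the value at `y` then follows from the
    -- barycentric relation.
    set x : Fin n → ℂ := T⁻¹ *ᵥ fun j => ℓ j.succ - ℓ 0 with hx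
    have hTx : T *ᵥ x = fun j => ℓ j.succ - ℓ 0 := by
      rw [hx, Matrix.mulVec_mulVec, Matrix.mul_nonsing_inv _ hTdet, Matrix.one_mulVec]
    have hαx : ∀ i, ∑ k, (α i k : ℂ) * x k = ℓ i - ℓ 0 := by
      refine Fin.cases ?_ fun j => ?_
      · simp [hq.zero]
      · simpa [Matrix.mulVec, dotProduct, hT, intMat] using congrFun hTx j
    have hyx : ∑ k, (y k : ℂ) * x k = -ℓ 0 := by
      refine mul_left_cancel₀ hp ?_
      push_cast
      calc (∑ i, (q i : ℂ)) * ∑ k, (y k : ℂ) * x k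
          = ∑ k, ((∑ i, (q i : ℂ)) * y k) * x k := by
            rw [Finset.mul_sum]; exact Finset.sum_congr rfl fun k _ => by ring
        _ = ∑ i, (q i : ℂ) * ∑ k, (α i k : ℂ) * x k := by
            simp only [← hq.rel_cast, Finset.sum_mul, Finset.mul_sum]
            rw [Finset.sum_comm]
            exact Finset.sum_congr rfl fun k _ => Finset.sum_congr rfl fun i _ => by ring
        _ = _ := by
            simp only [hαx, mul_sub]
            rw [Finset.sum_sub_distrib, hℓsum, ← Finset.sum_mul]
            ring
    have hmon : ∀ a : Fin n → ℤ,
        monom a (fun k => Complex.exp (x k)) = Complex.exp (∑ k, (a k : ℂ) * x k) := by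
      intro a
      rw [monom, Complex.exp_sum]
      exact Finset.prod_congr rfl fun k _ => (Complex.exp_int_mul _ _).symm
    refine ⟨fun k => Complex.exp (x k), fun k => Complex.exp_ne_zero _, fun i => ?_⟩
    rw [hmon, hmon, hαx, hyx, sub_eq_add_neg, Complex.exp_add, hℓexp, hρ]
    have := hb i
    push_cast at hp ⊢
    field_simp

end IsWeights

end Lattice

/-! ### Pseudo-division by a binomial in the last variable. -/

section PseudoDivision

open MvPolynomial

variable {ι R : Type*} [CommRing R]

/-- The binomial `e₁ ∏ bᵢ ^ mᵢ + e₂ c ^ p`, where `c` is the variable `none`. -/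
noncomputable def binomial (m : Option ι →₀ ℕ) (p : ℕ) (e₁ e₂ : R) :
    MvPolynomial (Option ι) R :=
  monomial m e₁ + monomial (Finsupp.single none p) e₂

/-- Replacing `c ^ p` by a multiple of the monomial `m`, which does not involve `c`, lowers the
degree in `c` by `p`. Powers of `e₂` stand in for division, so that the result holds over `ℤ` as
well as over `ℂ`. -/
theorem exists_pseudoDivision_monomial {m : Option ι →₀ ℕ} (hm : m none = 0) {p : ℕ}
    (hp : 0 < p) (e₁ e₂ : R) (k : ℕ) :
    ∀ (d : Option ι →₀ ℕ) (a : R), d none = k →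
      ∃ (N : ℕ) (Q r : MvPolynomial (Option ι) R),
        C (e₂ ^ N) * monomial d a = binomial m p e₁ e₂ * Q + r ∧
        ∀ d, p ≤ d none → coeff d r = 0 := by
  classical
  induction k using Nat.strong_induction_on with
  | _ k ih =>
    intro d a hd
    by_cases hk : k < p
    · refine ⟨0, 0, monomial d a, by simp, fun d' hd' => ?_⟩
      rw [coeff_monomial, if_neg]
      rintro rfl
      omega
    · push Not at hk
      have hle : Finsupp.single none p ≤ d := by
        rw [Finsupp.single_le_iff]; omega
      obtain ⟨d', rfl⟩ := exists_add_of_le hle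
      obtain ⟨N, Q, r, h1, h2⟩ := ih (k - p) (by omega) (d' + m) (a * e₁) (by
        simp [hm] at hd ⊢; omega)
      refine ⟨N + 1, C (e₂ ^ N) * monomial d' a - Q, -r, ?_, fun d hd => by
        rw [coeff_neg, h2 d hd, neg_zero]⟩
      have e : C e₂ * monomial (Finsupp.single none p + d') a =
          binomial m p e₁ e₂ * monomial d' a - monomial (d' + m) (a * e₁) := by
        rw [binomial, add_mul, monomial_mul, monomial_mul, C_mul_monomial, add_comm d' m,
          mul_comm a e₁]
        ring
      rw [pow_succ, C_mul, mul_assoc, e]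
      linear_combination -h1

theorem exists_pseudoDivision {m : Option ι →₀ ℕ} (hm : m none = 0) {p : ℕ}
    (hp : 0 < p) (e₁ e₂ : R) (g : MvPolynomial (Option ι) R) :
    ∃ (N : ℕ) (Q r : MvPolynomial (Option ι) R),
      C (e₂ ^ N) * g = binomial m p e₁ e₂ * Q + r ∧ ∀ d, p ≤ d none → coeff d r = 0 := by
  induction g using MvPolynomial.induction_on' with
  | monomial d a => exact exists_pseudoDivision_monomial hm hp e₁ e₂ _ d a rfl
  | add f g hf hg =>
    obtain ⟨N, Q, r, h1, h2⟩ := hf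
    obtain ⟨N', Q', r', h1', h2'⟩ := hg
    refine ⟨N + N', C (e₂ ^ N') * Q + C (e₂ ^ N) * Q', C (e₂ ^ N') * r + C (e₂ ^ N) * r', ?_,
      fun d hd => ?_⟩
    · rw [pow_add, C_mul]
      linear_combination C (e₂ ^ N') * h1 + C (e₂ ^ N) * h1'
    · rw [coeff_add, coeff_C_mul, coeff_C_mul, h2 d hd, h2' d hd]; simp

end PseudoDivision

/-! ### Monomial parametrization of `∇₀` and its vanishing ideal. -/

section Discriminant

open MvPolynomial

variable {n : ℕ} {α : Fin (n + 1) → Fin n → ℤ} {y : Fin n → ℤ} {q : Fin (n + 1) → ℕ}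

/-- The exponents of the monomial parametrization of `∇₀`, shifted to be natural numbers. -/
noncomputable def shifted (α : Fin (n + 1) → Fin n → ℤ) (y : Fin n → ℤ) (L : ℤ)
    (a : Option (Fin (n + 1))) : Option (Fin n) →₀ ℕ :=
  Finsupp.equivFunOnFinite.symm fun x => x.elim 1 fun k => (exponents α y a k + L).toNat

/-- The coefficients of the monomial parametrization of `∇₀`. -/
def weightCoeff (q : Fin (n + 1) → ℕ) (a : Option (Fin (n + 1))) : ℂ :=
  a.elim ((∑ i, q i : ℕ) : ℂ) fun i => -(q i : ℂ)

/-- The homomorphism of polynomial rings dual to the monomial parametrization of `∇₀`. -/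
noncomputable def paramHom (α : Fin (n + 1) → Fin n → ℤ) (y : Fin n → ℤ)
    (q : Fin (n + 1) → ℕ) (L : ℤ) :
    MvPolynomial (Option (Fin (n + 1))) ℂ →ₐ[ℂ] MvPolynomial (Option (Fin n)) ℂ :=
  aeval fun a => monomial (shifted α y L a) (weightCoeff q a)

theorem exists_shift (α : Fin (n + 1) → Fin n → ℤ) (y : Fin n → ℤ) :
    ∃ L : ℤ, ∀ a k, 0 ≤ exponents α y a k + L := by
  refine ⟨∑ a, ∑ k, |exponents α y a k|, fun a k => ?_⟩
  have h1 : |exponents α y a k| ≤ ∑ k, |exponents α y a k| :=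
    Finset.single_le_sum (f := fun k => |exponents α y a k|) (fun _ _ => abs_nonneg _)
      (Finset.mem_univ k)
  have h2 : ∑ k, |exponents α y a k| ≤ ∑ a, ∑ k, |exponents α y a k| :=
    Finset.single_le_sum (f := fun a => ∑ k, |exponents α y a k|)
      (fun _ _ => Finset.sum_nonneg fun _ _ => abs_nonneg _) (Finset.mem_univ a)
  have h3 := neg_abs_le (exponents α y a k)
  linarith

theorem paramHom_monomial (L : ℤ) (d : Option (Fin (n + 1)) →₀ ℕ) (r : ℂ) :
    paramHom α y q L (monomial d r) =
      monomial (∑ a, d a • shifted α y L a) (r * ∏ a, weightCoeff q a ^ d a) := by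
  rw [paramHom, aeval_monomial, Finsupp.prod_fintype _ _ fun _ => pow_zero _]
  simp only [monomial_pow]
  rw [← monomial_sum_prod, algebraMap_eq, C_mul_monomial]

theorem eval_paramHom (L : ℤ) (g : MvPolynomial (Option (Fin (n + 1))) ℂ)
    (t : Option (Fin n) → ℂ) :
    eval t (paramHom α y q L g) =
      aeval (fun a => weightCoeff q a * ∏ x, t x ^ shifted α y L a x) g := by
  have : (aeval t : MvPolynomial (Option (Fin n)) ℂ →ₐ[ℂ] ℂ).comp (paramHom α y q L) =
      aeval (fun a => weightCoeff q a * ∏ x, t x ^ shifted α y L a x) := by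
    refine algHom_ext fun a => ?_
    rw [AlgHom.comp_apply, paramHom, aeval_X, aeval_X, aeval_monomial,
      Finsupp.prod_fintype _ _ fun _ => pow_zero _]
    rfl
  rw [← this]
  rfl

theorem prod_shifted {L : ℤ} (hL : ∀ a k, 0 ≤ exponents α y a k + L)
    {t : Option (Fin n) → ℂ} (ht : ∀ x, t x ≠ 0) (a : Option (Fin (n + 1))) :
    ∏ x, t x ^ shifted α y L a x =
      t none * (monom (exponents α y a) (fun k => t (some k)) * ∏ k, t (some k) ^ L) := by
  rw [Fintype.prod_option, monom, ← Finset.prod_mul_distrib]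
  congr 1
  · simp [shifted]
  · refine Finset.prod_congr rfl fun k _ => ?_
    rw [← zpow_add₀ (ht _), ← zpow_natCast]
    simp [shifted, Int.toNat_of_nonneg (hL a k)]

theorem monom_inv (a : Fin n → ℤ) (z : Fin n → ℂ) :
    monom a (fun k => (z k)⁻¹) = (monom a z)⁻¹ := by
  simp [monom]

theorem monom_ne_zero (a : Fin n → ℤ) {z : Fin n → ℂ} (hz : ∀ k, z k ≠ 0) : monom a z ≠ 0 :=
  Finset.prod_ne_zero_iff.2 fun k _ => zpow_ne_zero _ (hz k)

namespace IsWeights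

theorem weightCoeff_ne_zero (hq : IsWeights α y q) (a : Option (Fin (n + 1))) :
    weightCoeff q a ≠ 0 := by
  cases a with
  | none => simpa [weightCoeff] using
      (show ((∑ i, q i : ℕ) : ℂ) ≠ 0 by exact_mod_cast hq.sum_pos.ne')
  | some i => simpa [weightCoeff] using (hq.pos i).ne'

theorem mem_nablaZero_iff_exists (hq : IsWeights α y q) {L : ℤ}
    (hL : ∀ a k, 0 ≤ exponents α y a k + L) (v : Option (Fin (n + 1)) → ℂ) :
    v ∈ nablaZero (exponents α y) ↔ ∃ t : Option (Fin n) → ℂ, (∀ x, t x ≠ 0) ∧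
      v = fun a => weightCoeff q a * ∏ x, t x ^ shifted α y L a x := by
  have hp : (∑ i, (q i : ℂ)) ≠ 0 := by exact_mod_cast hq.sum_pos.ne'
  rw [hq.mem_nablaZero_iff]
  constructor
  · rintro ⟨hv, z, hz, h⟩
    have hP : ∏ k, (z k) ^ L ≠ 0 := Finset.prod_ne_zero_iff.2 fun k _ => zpow_ne_zero _ (hz k)
    -- The equations read `c z^y = p s` and `b_i z^α(i) = -q_i s` with a common `s`. Inverting `z`
    -- solves them for the coefficients, and the factor `z ^ L` undoes the shift of exponents.
    have ht : ∀ x : Option (Fin n), x.elim (v none * monom y z * (∏ k, (z k) ^ L) /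
        (∑ i, (q i : ℂ))) (fun k => (z k)⁻¹) ≠ 0 := by
      intro x
      cases x with
      | none => exact div_ne_zero (mul_ne_zero (mul_ne_zero (hv _) (monom_ne_zero y hz)) hP) hp
      | some k => exact inv_ne_zero (hz k)
    refine ⟨_, ht, funext fun a => ?_⟩
    rw [prod_shifted hL ht]
    simp only [Option.elim, monom_inv, inv_zpow, Finset.prod_inv_distrib]
    cases a with
    | none =>
      have := monom_ne_zero y hz
      simp only [weightCoeff, exponents, Option.elim]
      push_cast
      field_simp
    | some i =>
      have := monom_ne_zero (α i) hz
      have hi := h i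
      simp only [weightCoeff, exponents, Option.elim]
      field_simp
      linear_combination hi
  · rintro ⟨t, ht, rfl⟩
    refine ⟨fun a => mul_ne_zero (hq.weightCoeff_ne_zero a)
      (Finset.prod_ne_zero_iff.2 fun x _ => pow_ne_zero _ (ht x)),
      fun k => (t (some k))⁻¹, fun k => inv_ne_zero (ht _), fun i => ?_⟩
    have h1 := monom_ne_zero (α i) fun k => ht (some k)
    have h2 := monom_ne_zero y fun k => ht (some k)
    simp only [prod_shifted hL ht, monom_inv]
    simp only [weightCoeff, exponents, Option.elim]
    push_cast
    field_simp

theorem mem_vanishingIdeal_iff (hq : IsWeights α y q) {L : ℤ}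
    (hL : ∀ a k, 0 ≤ exponents α y a k + L) (g : MvPolynomial (Option (Fin (n + 1))) ℂ) :
    g ∈ vanishingIdeal ℂ (nablaZero (exponents α y)) ↔ paramHom α y q L g = 0 := by
  rw [MvPolynomial.mem_vanishingIdeal_iff]
  constructor
  · intro h
    -- The parameters run only over the torus; the factor `∏ X x` takes care of the coordinate
    -- hyperplanes.
    have h1 : paramHom α y q L g * ∏ x, X x = 0 := by
      refine MvPolynomial.funext fun t => ?_
      rw [map_mul, map_prod, map_zero]
      simp only [eval_X]
      by_cases ht : ∀ x, t x ≠ 0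
      · rw [eval_paramHom, h _ ((hq.mem_nablaZero_iff_exists hL _).2 ⟨t, ht, rfl⟩), zero_mul]
      · push Not at ht
        obtain ⟨x, hx⟩ := ht
        rw [Finset.prod_eq_zero (Finset.mem_univ x) hx, mul_zero]
    exact (mul_eq_zero.1 h1).resolve_right (Finset.prod_ne_zero_iff.2 fun x _ => X_ne_zero x)
  · intro h v hv
    obtain ⟨t, -, rfl⟩ := (hq.mem_nablaZero_iff_exists hL v).1 hv
    rw [← eval_paramHom, h, map_zero]

theorem isPrime_vanishingIdeal (hq : IsWeights α y q) :
    (vanishingIdeal ℂ (nablaZero (exponents α y))).IsPrime := by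
  obtain ⟨L, hL⟩ := exists_shift α y
  have : vanishingIdeal ℂ (nablaZero (exponents α y)) = RingHom.ker (paramHom α y q L) := by
    ext g
    rw [hq.mem_vanishingIdeal_iff hL, RingHom.mem_ker]
  rw [this]
  exact RingHom.ker_isPrime _

/-- The difference of two exponents with the same image is an integral affine relation. As the
weights are coprime, its entry at `y` is divisible by `p`, and being smaller than `p` in absolute
value it is zero. -/
theorem sum_smul_shifted_injOn (hq : IsWeights α y q) {L : ℤ}
    (hL : ∀ a k, 0 ≤ exponents α y a k + L) {d d' : Option (Fin (n + 1)) →₀ ℕ}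
    (hd : d none < ∑ i, q i) (hd' : d' none < ∑ i, q i)
    (h : ∑ a, d a • shifted α y L a = ∑ a, d' a • shifted α y L a) : d = d' := by
  have hx : ∀ x, ∑ a, d a * shifted α y L a x = ∑ a, d' a * shifted α y L a x := fun x => by
    simpa [Finsupp.finsetSum_apply] using DFunLike.congr_fun h x
  have h0 : ∑ a, (d a : ℤ) = ∑ a, (d' a : ℤ) := by
    have := hx none
    have hs : ∀ a, shifted α y L a none = 1 := fun _ => rfl
    simp only [hs, mul_one] at this
    exact_mod_cast this
  have hk : ∀ k, ∑ a, (d a : ℤ) * exponents α y a k = ∑ a, (d' a : ℤ) * exponents α y a k := by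
    intro k
    have h1 := congrArg (Nat.cast : ℕ → ℤ) (hx (some k))
    have hs : ∀ a, ((shifted α y L a (some k) : ℕ) : ℤ) = exponents α y a k + L :=
      fun a => Int.toNat_of_nonneg (hL a k)
    push_cast at h1
    simp only [hs, mul_add, Finset.sum_add_distrib, ← Finset.sum_mul, h0] at h1
    linarith
  have hrel : ∀ i, (∑ j, (q j : ℤ)) * ((d (some i) : ℤ) - d' (some i)) =
      -(q i : ℤ) * ((d none : ℤ) - d' none) := by
    intro i
    have h2 := hq.eq_of_relation (K := ℚ) (u := fun i => (d (some i) : ℚ) - d' (some i))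
      (v := (d none : ℚ) - d' none) (by
        have := congrArg (Int.cast : ℤ → ℚ) h0
        push_cast at this
        rw [Fintype.sum_option, Fintype.sum_option] at this
        rw [Finset.sum_sub_distrib]
        linarith) (fun k => by
        have := congrArg (Int.cast : ℤ → ℚ) (hk k)
        push_cast at this
        rw [Fintype.sum_option, Fintype.sum_option] at this
        simp only [exponents, Option.elim] at this
        simp only [sub_mul]
        rw [Finset.sum_sub_distrib]
        linarith) i
    exact_mod_cast h2
  obtain ⟨k, hk'⟩ := hq.exists_bezout
  have hdvd : (∑ j, (q j : ℤ)) ∣ (d none : ℤ) - d' none := by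
    refine ⟨-∑ i, k i * ((d (some i) : ℤ) - d' (some i)), ?_⟩
    rw [mul_neg, Finset.mul_sum]
    have e : ∀ i, (∑ j, (q j : ℤ)) * (k i * ((d (some i) : ℤ) - d' (some i))) =
        -(q i * k i * ((d none : ℤ) - d' none)) := fun i => by
      linear_combination k i * hrel i
    simp only [e]
    rw [Finset.sum_neg_distrib, neg_neg, ← Finset.sum_mul, hk', one_mul]
  have hzero : (d none : ℤ) - d' none = 0 := by
    refine Int.eq_zero_of_abs_lt_dvd hdvd ?_
    rw [abs_lt]
    have : ((∑ i, q i : ℕ) : ℤ) = ∑ j, (q j : ℤ) := by push_cast; rfl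
    constructor <;> omega
  have hpos : (∑ j, (q j : ℤ)) ≠ 0 := by exact_mod_cast hq.sum_pos.ne'
  refine Finsupp.ext fun a => ?_
  cases a with
  | none => omega
  | some i =>
    have h3 := hrel i
    rw [hzero, mul_zero] at h3
    have := (mul_eq_zero.1 h3).resolve_left hpos
    omega

/-- A polynomial vanishing on `∇₀` of degree less than `∑ qᵢ` in the last variable is zero. -/
theorem eq_zero_of_mem_vanishingIdeal (hq : IsWeights α y q)
    {r : MvPolynomial (Option (Fin (n + 1))) ℂ} (hr : ∀ d, ∑ i, q i ≤ d none → coeff d r = 0)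
    (h : r ∈ vanishingIdeal ℂ (nablaZero (exponents α y))) : r = 0 := by
  obtain ⟨L, hL⟩ := exists_shift α y
  rw [hq.mem_vanishingIdeal_iff hL] at h
  by_contra hr0
  obtain ⟨d, hd⟩ := Finset.nonempty_iff_ne_empty.2 fun h0 => hr0 (support_eq_empty.1 h0)
  have hlt : ∀ d ∈ r.support, d none < ∑ i, q i := fun d hd => by
    by_contra hle
    exact mem_support_iff.1 hd (hr d (not_lt.1 hle))
  -- The monomials of `r` have distinct images, so only `d` contributes to this coefficient.
  have h1 := congrArg (coeff (∑ a, d a • shifted α y L a)) h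
  conv_lhs at h1 => rw [r.as_sum]
  rw [map_sum, coeff_sum, coeff_zero, Finset.sum_eq_single d] at h1
  · rw [paramHom_monomial, coeff_monomial, if_pos rfl] at h1
    exact mul_ne_zero (mem_support_iff.1 hd)
      (Finset.prod_ne_zero_iff.2 fun a _ => pow_ne_zero _ (hq.weightCoeff_ne_zero a)) h1
  · intro d' hd' hne
    rw [paramHom_monomial, coeff_monomial, if_neg]
    exact fun he => hne (hq.sum_smul_shifted_injOn hL (hlt d' hd') (hlt d hd) he)
  · exact fun h => absurd hd h

end IsWeights

end Discriminant

/-! ### The binomial is the discriminant, uniquely up to sign. -/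

section Binomial

open MvPolynomial

variable {n : ℕ} {α : Fin (n + 1) → Fin n → ℤ} {y : Fin n → ℤ} {q : Fin (n + 1) → ℕ}

/-- The exponent vector with entries `qᵢ` and `0` at `none`. -/
noncomputable def weightExponent (q : Fin (n + 1) → ℕ) : Option (Fin (n + 1)) →₀ ℕ :=
  Finsupp.equivFunOnFinite.symm fun a => a.elim 0 q

/-- The binomial relation `p ^ p ∏ bᵢ ^ qᵢ = (-1) ^ p ∏ qᵢ ^ qᵢ c ^ p`, with `p = ∑ qᵢ`. -/
def BinomialRel (q : Fin (n + 1) → ℕ) (b : Fin (n + 1) → ℂ) (c : ℂ) : Prop :=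
  ((∑ i, q i : ℕ) : ℂ) ^ (∑ i, q i) * ∏ i, b i ^ q i =
    (-1) ^ (∑ i, q i) * (∏ i, (q i : ℂ) ^ q i) * c ^ ∑ i, q i

theorem BinomialRel.smul {b : Fin (n + 1) → ℂ} {c : ℂ} (h : BinomialRel q b c) (a : ℂ) :
    BinomialRel q (fun i => a * b i) (a * c) := by
  unfold BinomialRel at h ⊢
  simp only [mul_pow, Finset.prod_mul_distrib, Finset.prod_pow_eq_pow_sum]
  linear_combination a ^ (∑ i, q i) * h

/-- Coprime integers proportional to the coefficients of the binomial relation. -/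
structure IsRelCoeffs (q : Fin (n + 1) → ℕ) (e₁ e₂ : ℤ) : Prop where
  coprime : IsCoprime e₁ e₂
  left_ne_zero : e₁ ≠ 0
  right_ne_zero : e₂ ≠ 0
  proportional : ∃ g : ℤ, g ≠ 0 ∧ ((∑ i, q i : ℕ) : ℤ) ^ (∑ i, q i) = e₁ * g ∧
    -((-1) ^ (∑ i, q i) * ∏ i, (q i : ℤ) ^ q i) = e₂ * g

theorem aeval_binomial (e₁ e₂ : ℤ) (v : Option (Fin (n + 1)) → ℂ) :
    aeval v (binomial (weightExponent q) (∑ i, q i) e₁ e₂) =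
      e₁ * ∏ i, v (some i) ^ q i + e₂ * v none ^ ∑ i, q i := by
  rw [binomial, map_add, aeval_monomial, aeval_monomial,
    Finsupp.prod_fintype _ _ fun _ => pow_zero _, Fintype.prod_option,
    Finsupp.prod_single_index (h := fun i k => v i ^ k) (pow_zero _)]
  simp [weightExponent]

theorem IsRelCoeffs.aeval_eq_zero_iff {e₁ e₂ : ℤ} (he : IsRelCoeffs q e₁ e₂)
    (v : Option (Fin (n + 1)) → ℂ) :
    aeval v (binomial (weightExponent q) (∑ i, q i) e₁ e₂) = 0 ↔
      BinomialRel q (fun i => v (some i)) (v none) := by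
  obtain ⟨g, hg, h1, h2⟩ := he.proportional
  have hg' : (g : ℂ) ≠ 0 := by exact_mod_cast hg
  have h1' := congrArg (Int.cast : ℤ → ℂ) h1
  have h2' := congrArg (Int.cast : ℤ → ℂ) h2
  rw [aeval_binomial, BinomialRel, ← mul_right_inj' hg', mul_zero, ← sub_eq_zero (b := _ * _ * _)]
  push_cast at h1' h2' ⊢
  rw [h1', show (-1 : ℂ) ^ (∑ i, q i) * ∏ i, (q i : ℂ) ^ q i = -(e₂ * g) by rw [← h2', neg_neg]]
  refine Eq.congr ?_ rfl
  ring

namespace IsWeights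

theorem exists_isRelCoeffs (hq : IsWeights α y q) : ∃ e₁ e₂ : ℤ, IsRelCoeffs q e₁ e₂ := by
  have h1 : ((∑ i, q i : ℕ) : ℤ) ^ (∑ i, q i) ≠ 0 :=
    pow_ne_zero _ (by exact_mod_cast hq.sum_pos.ne')
  have h2 : -((-1) ^ (∑ i, q i) * ∏ i, (q i : ℤ) ^ q i) ≠ 0 :=
    neg_ne_zero.2 (mul_ne_zero (pow_ne_zero _ (by norm_num))
      (Finset.prod_ne_zero_iff.2 fun i _ => pow_ne_zero _ (by exact_mod_cast (hq.pos i).ne')))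
  obtain ⟨e₁, e₂, h3, h4, h5⟩ := Int.exists_gcd_one (Int.gcd_pos_of_ne_zero_left _ h1)
  refine ⟨e₁, e₂, Int.isCoprime_iff_gcd_eq_one.2 h3, ?_, ?_, _,
    by exact_mod_cast (Int.gcd_pos_of_ne_zero_left _ h1).ne', h4, h5⟩
  · rintro rfl; rw [zero_mul] at h4; exact h1 h4
  · rintro rfl; rw [zero_mul] at h5; exact h2 h5

theorem weightExponent_ne (hq : IsWeights α y q) :
    weightExponent q ≠ Finsupp.single none (∑ i, q i) := by
  intro h
  have : (0 : ℕ) = ∑ i, q i := by simpa [weightExponent] using DFunLike.congr_fun h none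
  exact hq.sum_pos.ne this

theorem coeff_weightExponent {R : Type*} [CommRing R] (hq : IsWeights α y q) (e₁ e₂ : R) :
    coeff (weightExponent q) (binomial (weightExponent q) (∑ i, q i) e₁ e₂) = e₁ := by
  classical
  rw [binomial, coeff_add, coeff_monomial, coeff_monomial, if_pos rfl,
    if_neg hq.weightExponent_ne.symm, add_zero]

theorem coeff_single_none {R : Type*} [CommRing R] (hq : IsWeights α y q) (e₁ e₂ : R) :
    coeff (Finsupp.single none (∑ i, q i))
      (binomial (weightExponent q) (∑ i, q i) e₁ e₂) = e₂ := by
  classical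
  rw [binomial, coeff_add, coeff_monomial, coeff_monomial, if_pos rfl,
    if_neg hq.weightExponent_ne, zero_add]

theorem support_binomial_card (hq : IsWeights α y q) {e₁ e₂ : ℤ} (he : IsRelCoeffs q e₁ e₂) :
    (binomial (weightExponent q) (∑ i, q i) e₁ e₂).support.card = 2 := by
  classical
  have : (binomial (weightExponent q) (∑ i, q i) e₁ e₂).support =
      {weightExponent q, Finsupp.single none (∑ i, q i)} := by
    ext d
    simp only [mem_support_iff, Finset.mem_insert, Finset.mem_singleton]
    constructor
    · contrapose!
      rintro ⟨h1, h2⟩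
      rw [binomial, coeff_add, coeff_monomial, coeff_monomial, if_neg h1.symm, if_neg h2.symm,
        add_zero]
    · rintro (rfl | rfl)
      · rw [hq.coeff_weightExponent]; exact he.left_ne_zero
      · rw [hq.coeff_single_none]; exact he.right_ne_zero
  rw [this, Finset.card_pair hq.weightExponent_ne]

theorem mem_nablaZero_iff_binomialRel (hq : IsWeights α y q) (v : Option (Fin (n + 1)) → ℂ) :
    v ∈ nablaZero (exponents α y) ↔
      (∀ i, v i ≠ 0) ∧ BinomialRel q (fun i => v (some i)) (v none) := by
  rw [hq.mem_nablaZero_iff]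
  exact and_congr_right fun hv => hq.exists_isSingularZero_iff (fun i => hv _) (hv _)

theorem map_binomial_mem (hq : IsWeights α y q) {e₁ e₂ : ℤ} (he : IsRelCoeffs q e₁ e₂) :
    map (Int.castRingHom ℂ) (binomial (weightExponent q) (∑ i, q i) e₁ e₂) ∈
      vanishingIdeal ℂ (nablaZero (exponents α y)) := by
  rw [MvPolynomial.mem_vanishingIdeal_iff]
  intro v hv
  have := (he.aeval_eq_zero_iff v).2 ((hq.mem_nablaZero_iff_binomialRel v).1 hv).2
  rwa [← algebraMap_int_eq, aeval_map_algebraMap]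

theorem map_binomial_eq (m : Option (Fin (n + 1)) →₀ ℕ) (p : ℕ) (e₁ e₂ : ℤ) :
    map (Int.castRingHom ℂ) (binomial m p e₁ e₂) = binomial m p (e₁ : ℂ) (e₂ : ℂ) := by
  simp [binomial, map_monomial]

theorem map_binomial_ne_zero (hq : IsWeights α y q) {e₁ e₂ : ℤ} (he : IsRelCoeffs q e₁ e₂) :
    map (Int.castRingHom ℂ) (binomial (weightExponent q) (∑ i, q i) e₁ e₂) ≠ 0 := by
  intro h
  have h1 := hq.coeff_weightExponent (e₁ : ℂ) (e₂ : ℂ)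
  rw [← map_binomial_eq, h, coeff_zero] at h1
  exact he.left_ne_zero (by exact_mod_cast h1.symm)

/-- The remainder on pseudo-division lies in the ideal and has degree less than `p` in `c`, so it is
zero; over `ℂ` the power of `e₂` can be inverted. -/
theorem vanishingIdeal_eq_span (hq : IsWeights α y q) {e₁ e₂ : ℤ} (he : IsRelCoeffs q e₁ e₂) :
    vanishingIdeal ℂ (nablaZero (exponents α y)) =
      Ideal.span {map (Int.castRingHom ℂ) (binomial (weightExponent q) (∑ i, q i) e₁ e₂)} := by
  have hmem := hq.map_binomial_mem he
  refine le_antisymm (fun g hg => ?_) ((Ideal.span_singleton_le_iff_mem _).2 hmem)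
  rw [Ideal.mem_span_singleton]
  rw [map_binomial_eq] at hmem ⊢
  obtain ⟨N, Q, r, h1, h2⟩ := exists_pseudoDivision (m := weightExponent q) rfl hq.sum_pos
    (e₁ : ℂ) (e₂ : ℂ) g
  have hr : r ∈ vanishingIdeal ℂ (nablaZero (exponents α y)) := by
    rw [eq_sub_iff_add_eq'.2 h1.symm]
    exact Ideal.sub_mem _ (Ideal.mul_mem_left _ _ hg) (Ideal.mul_mem_right _ _ hmem)
  rw [hq.eq_zero_of_mem_vanishingIdeal h2 hr, add_zero] at h1
  have he2 : ((e₂ : ℂ) ^ N) ≠ 0 := pow_ne_zero _ (by exact_mod_cast he.right_ne_zero)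
  refine ⟨C ((e₂ : ℂ) ^ N)⁻¹ * Q, ?_⟩
  rw [mul_left_comm, ← h1, ← mul_assoc, ← C_mul, inv_mul_cancel₀ he2, C_1, one_mul]

theorem prime_map_binomial (hq : IsWeights α y q) {e₁ e₂ : ℤ} (he : IsRelCoeffs q e₁ e₂) :
    Prime (map (Int.castRingHom ℂ) (binomial (weightExponent q) (∑ i, q i) e₁ e₂)) := by
  rw [← Ideal.span_singleton_prime (hq.map_binomial_ne_zero he), ← hq.vanishingIdeal_eq_span he]
  exact hq.isPrime_vanishingIdeal

/-- Over `ℂ` the binomial generates a prime ideal, so one factor becomes constant there. A constant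
integer factor divides both coprime coefficients, hence is a unit. -/
theorem irreducible_binomial (hq : IsWeights α y q) {e₁ e₂ : ℤ} (he : IsRelCoeffs q e₁ e₂) :
    Irreducible (binomial (weightExponent q) (∑ i, q i) e₁ e₂) := by
  have hirr := (hq.prime_map_binomial he).irreducible
  have hunit : ∀ f, f ∣ binomial (weightExponent q) (∑ i, q i) e₁ e₂ →
      IsUnit (map (Int.castRingHom ℂ) f) → IsUnit f := by
    intro f hf hu
    rw [isUnit_iff_totalDegree_of_isReduced, totalDegree,
      support_map_of_injective _ (RingHom.injective_int (Int.castRingHom ℂ))] at hu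
    have hfC := (totalDegree_eq_zero_iff_eq_C (p := f)).1 hu.2
    rw [hfC] at hf ⊢
    rw [C_dvd_iff_dvd_coeff] at hf
    have h1 := hf (weightExponent q)
    have h2 := hf (Finsupp.single none (∑ i, q i))
    rw [hq.coeff_weightExponent] at h1
    rw [hq.coeff_single_none] at h2
    exact (he.coprime.isUnit_of_dvd' h1 h2).map C
  refine ⟨fun h => hirr.not_isUnit (h.map _), fun f g hfg => ?_⟩
  exact (hirr.isUnit_or_isUnit (by rw [hfg, map_mul])).imp
    (hunit f (hfg ▸ dvd_mul_right f g)) (hunit g (hfg ▸ dvd_mul_left g f))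

theorem vanishingIdeal_nabla : vanishingIdeal ℂ (nabla (exponents α y)) =
    vanishingIdeal ℂ (nablaZero (exponents α y)) := by
  refine le_antisymm (vanishingIdeal_anti_mono (zeroLocus_vanishingIdeal_le _)) ?_
  exact le_vanishingIdeal_zeroLocus _

theorem isADiscriminant_binomial (hq : IsWeights α y q) {e₁ e₂ : ℤ} (he : IsRelCoeffs q e₁ e₂) :
    IsADiscriminant (exponents α y) (binomial (weightExponent q) (∑ i, q i) e₁ e₂) := by
  have hprime := hq.prime_map_binomial he
  refine ⟨?_, hq.irreducible_binomial he, fun b hb => ?_⟩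
  · rw [vanishingIdeal_nabla, hq.vanishingIdeal_eq_span he]
    exact Ideal.height_span_singleton_eq_one_of_mem_nonZeroDivisors
      (mem_nonZeroDivisors_of_ne_zero hprime.ne_zero) hprime.not_isUnit
  · have := hb _ (hq.map_binomial_mem he)
    rwa [← algebraMap_int_eq, aeval_map_algebraMap] at this

/-- The discriminant is unique up to sign. -/
theorem associated_of_isADiscriminant (hq : IsWeights α y q) {e₁ e₂ : ℤ}
    (he : IsRelCoeffs q e₁ e₂) {Δ : MvPolynomial (Option (Fin (n + 1))) ℤ}
    (hΔ : IsADiscriminant (exponents α y) Δ) :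
    Associated (binomial (weightExponent q) (∑ i, q i) e₁ e₂) Δ := by
  obtain ⟨-, hirr, hvan⟩ := hΔ
  have hmem : map (Int.castRingHom ℂ) Δ ∈ vanishingIdeal ℂ (nablaZero (exponents α y)) := by
    rw [MvPolynomial.mem_vanishingIdeal_iff]
    intro v hv
    rw [← algebraMap_int_eq, aeval_map_algebraMap]
    exact hvan v (zeroLocus_vanishingIdeal_le _ hv)
  obtain ⟨N, Q, r, h1, h2⟩ := exists_pseudoDivision (m := weightExponent q) rfl hq.sum_pos e₁ e₂ Δ
  have hr : map (Int.castRingHom ℂ) r ∈ vanishingIdeal ℂ (nablaZero (exponents α y)) := by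
    rw [eq_sub_iff_add_eq'.2 h1.symm, map_sub, map_mul, map_mul]
    exact Ideal.sub_mem _ (Ideal.mul_mem_left _ _ hmem)
      (Ideal.mul_mem_right _ _ (hq.map_binomial_mem he))
  have hr0 := hq.eq_zero_of_mem_vanishingIdeal (fun d hd => by
    rw [coeff_map, h2 d hd, map_zero]) hr
  rw [map_injective _ (RingHom.injective_int (Int.castRingHom ℂ)) (hr0.trans (map_zero _).symm),
    add_zero] at h1
  have hB := hq.irreducible_binomial he
  -- The binomial is prime and divides `e₂ ^ N * Δ`. It cannot divide the constant, which becomes a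
  -- unit over `ℂ`.
  rcases hB.prime.dvd_or_dvd (Dvd.intro _ h1.symm) with h | h
  · refine absurd ?_ (hq.prime_map_binomial he).not_isUnit
    refine isUnit_of_dvd_unit (map_dvd (map (Int.castRingHom ℂ)) h) ?_
    rw [map_C]
    exact (IsUnit.mk0 _ (by simpa using fun h => absurd h he.right_ne_zero)).map C
  · exact hB.associated_of_dvd hirr h

end IsWeights

theorem isBinomial_of_associated {ι : Type*} {B Δ : MvPolynomial ι ℤ} (h : Associated B Δ)
    (hB : IsBinomial B) : IsBinomial Δ := by
  obtain ⟨u, rfl⟩ := h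
  have hu := isUnit_iff_totalDegree_of_isReduced.1 u.isUnit
  rw [IsBinomial, totalDegree_eq_zero_iff_eq_C.1 hu.2, mul_comm, C_mul', support_smul_eq]
  · exact hB
  · exact hu.1.ne_zero

theorem aeval_eq_zero_iff_of_associated {ι : Type*} {B Δ : MvPolynomial ι ℤ}
    (h : Associated B Δ) (v : ι → ℂ) : aeval v Δ = 0 ↔ aeval v B = 0 := by
  obtain ⟨u, rfl⟩ := h
  rw [map_mul, mul_eq_zero, or_iff_left (u.isUnit.map (aeval v)).ne_zero]

end Binomial

/-! ### The formula for `|c|` in terms of the weights. -/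

section Modulus

open scoped Matrix

variable {n : ℕ} {α : Fin (n + 1) → Fin n → ℤ} {y : Fin n → ℤ} {q : Fin (n + 1) → ℕ}

theorem detCol_mulVec (N : Matrix (Fin n) (Fin n) ℝ) (x : Fin n → ℝ) {s : ℝ}
    (h : N *ᵥ x = s • fun k => (y k : ℝ)) (j : Fin n) :
    s * detCol N y j = N.det * x j := by
  have h1 : N.cramer (N *ᵥ x) = N.det • x := by
    rw [Matrix.cramer_eq_adjugate_mulVec, Matrix.mulVec_mulVec, Matrix.adjugate_mul,
      Matrix.smul_mulVec, Matrix.one_mulVec]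
  rw [h, map_smul] at h1
  exact congrFun h1 j

namespace IsWeights

theorem matM_mulVec (hq : IsWeights α y q) :
    (matM α *ᵥ fun j => (q j.succ : ℝ)) = (∑ i, (q i : ℝ)) • fun k => (y k : ℝ) := by
  funext k
  have := hq.rel_cast (K := ℝ) k
  rw [Fin.sum_univ_succ (fun i => (q i : ℝ) * α i k)] at this
  simpa [hq.zero, Matrix.mulVec, dotProduct, matM, mul_comm] using this

theorem matMhat_mulVec (hq : IsWeights α y q) :
    (matMhat α y *ᵥ fun j => (q j.succ : ℝ)) = (q 0 : ℝ) • fun k => (y k : ℝ) := by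
  funext k
  have h1 := congrFun hq.matM_mulVec k
  simp only [Matrix.mulVec, dotProduct, matM, matMhat, Matrix.of_apply, Pi.smul_apply,
    smul_eq_mul, sub_mul, Finset.sum_sub_distrib] at h1 ⊢
  rw [h1, Fin.sum_univ_succ, ← Finset.mul_sum]
  ring

theorem det_matM_ne_zero (hq : IsWeights α y q) : (matM α).det ≠ 0 := by
  rw [det_matM]; exact_mod_cast hq.det_ne_zero

/-- A kernel vector of `M̂` is sent by `M` to a multiple of `y`, hence is proportional to the
weights `q 1, …, q n`. Comparing sums of entries forces the factor to vanish because `q 0 > 0`. -/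
theorem det_matMhat_ne_zero (hq : IsWeights α y q) : (matMhat α y).det ≠ 0 := by
  intro h0
  obtain ⟨x, hx, hx0⟩ := Matrix.exists_mulVec_eq_zero_iff.2 h0
  refine hx ?_
  have hp := sum_pos_of_pos hq.pos
  have h1 : (matM α *ᵥ ((∑ i, (q i : ℝ)) • x - (∑ j, x j) • fun j => (q j.succ : ℝ))) = 0 := by
    rw [Matrix.mulVec_sub, Matrix.mulVec_smul, Matrix.mulVec_smul, hq.matM_mulVec]
    funext k
    have := congrFun hx0 k
    simp only [Matrix.mulVec, dotProduct, matM, matMhat, Matrix.of_apply, Pi.smul_apply,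
      smul_eq_mul, sub_mul, Finset.sum_sub_distrib, Pi.zero_apply, Pi.sub_apply,
      ← Finset.mul_sum] at this ⊢
    linear_combination (∑ i, (q i : ℝ)) * this
  have h2 := Matrix.eq_zero_of_mulVec_eq_zero hq.det_matM_ne_zero h1
  have h3 : ∀ j, (∑ i, (q i : ℝ)) * x j = (∑ j, x j) * q j.succ := fun j => by
    have := congrFun h2 j
    simp only [Pi.sub_apply, Pi.smul_apply, smul_eq_mul, Pi.zero_apply] at this
    linarith
  have h4 : (∑ j, x j) * q 0 = 0 := by
    have h5 : ∑ j, (∑ i, (q i : ℝ)) * x j = ∑ j : Fin n, (∑ j, x j) * q j.succ :=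
      Finset.sum_congr rfl fun j _ => h3 j
    rw [← Finset.mul_sum, ← Finset.mul_sum, Fin.sum_univ_succ] at h5
    linear_combination h5
  have h6 : ∑ j, x j = 0 :=
    (mul_eq_zero.1 h4).resolve_right (by exact_mod_cast (hq.pos 0).ne')
  funext j
  have := h3 j
  rw [h6, zero_mul] at this
  exact (mul_eq_zero.1 this).resolve_left hp.ne'

theorem detCol_matM_div (hq : IsWeights α y q) (j : Fin n) :
    detCol (matM α) y j / (matM α).det = q j.succ / ∑ i, (q i : ℝ) := by
  have := detCol_mulVec _ _ hq.matM_mulVec j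
  rw [div_eq_div_iff hq.det_matM_ne_zero (sum_pos_of_pos hq.pos).ne']
  linarith

theorem detCol_matMhat_div (hq : IsWeights α y q) (j : Fin n) :
    detCol (matMhat α y) y j / (matMhat α y).det = q j.succ / (q 0 : ℝ) := by
  have := detCol_mulVec _ _ hq.matMhat_mulVec j
  rw [div_eq_div_iff hq.det_matMhat_ne_zero (by exact_mod_cast (hq.pos 0).ne')]
  linarith

theorem one_add_sum_detCol_div (hq : IsWeights α y q) :
    1 + ∑ j, detCol (matMhat α y) y j / (matMhat α y).det = (∑ i, (q i : ℝ)) / q 0 := by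
  have h0 : (q 0 : ℝ) ≠ 0 := by exact_mod_cast (hq.pos 0).ne'
  simp only [hq.detCol_matMhat_div]
  rw [← Finset.sum_div, Fin.sum_univ_succ, add_div, div_self h0]

theorem norm_thetaHat (hq : IsWeights α y q) (b : Fin (n + 1) → ℂ) :
    ‖thetaHat α y b‖ = ∏ j : Fin n, (‖b j.succ‖ * (q 0 / q j.succ)) ^
      ((q j.succ : ℝ) / ∑ i, (q i : ℝ)) := by
  rw [thetaHat, norm_prod]
  refine Finset.prod_congr rfl fun j _ => ?_
  rw [Complex.norm_cpow_real, hq.detCol_matM_div, mul_comm (_ : ℂ), mul_div_assoc, norm_mul]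
  congr 2
  rw [← Complex.ofReal_div, Complex.norm_real, ← inv_div, hq.detCol_matMhat_div, inv_div,
    Real.norm_of_nonneg (by positivity)]

/-- By Cramer's rule the determinant ratios are `q i / p` and `q i / q 0`. Raising to the power `p`
clears the fractional exponents, and `b 0 = 1` supplies the missing factor. -/
theorem norm_eq_iff (hq : IsWeights α y q) {b : Fin (n + 1) → ℂ} (hb0 : b 0 = 1) (c : ℂ) :
    ‖c‖ = ‖thetaHat α y b‖ *
        (1 + ∑ j, detCol (matMhat α y) y j / (matMhat α y).det) ↔
      ((∑ i, q i : ℕ) : ℝ) ^ (∑ i, q i) * ∏ i, ‖b i‖ ^ q i =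
        (∏ i, (q i : ℝ) ^ q i) * ‖c‖ ^ ∑ i, q i := by
  have hp := sum_pos_of_pos hq.pos
  have hqi : ∀ i, (0 : ℝ) < q i := fun i => by exact_mod_cast hq.pos i
  rw [hq.one_add_sum_detCol_div, hq.norm_thetaHat,
    ← pow_left_inj₀ (norm_nonneg c) (by positivity) hq.sum_pos.ne', mul_pow, ← Finset.prod_pow]
  have h1 : ∀ j : Fin n, ((‖b j.succ‖ * (q 0 / q j.succ)) ^
      ((q j.succ : ℝ) / ∑ i, (q i : ℝ))) ^ (∑ i, q i) =
      ‖b j.succ‖ ^ q j.succ * (q 0 ^ q j.succ / q j.succ ^ q j.succ) := by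
    intro j
    rw [← Real.rpow_natCast, ← Real.rpow_mul (by positivity)]
    push_cast
    rw [div_mul_cancel₀ _ hp.ne', Real.rpow_natCast, mul_pow, div_pow]
  simp only [h1]
  rw [Finset.prod_mul_distrib, Finset.prod_div_distrib, Finset.prod_pow_eq_pow_sum, div_pow,
    Fin.prod_univ_succ (fun i => ‖b i‖ ^ q i), Fin.prod_univ_succ (fun i => (q i : ℝ) ^ q i),
    hb0, norm_one, one_pow, one_mul]
  have h2 : (q 0 : ℝ) ^ (∑ i, q i) = q 0 ^ q 0 * q 0 ^ ∑ j : Fin n, q j.succ := by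
    rw [← pow_add, Fin.sum_univ_succ]
  have h3 : ∏ j : Fin n, (q j.succ : ℝ) ^ q j.succ ≠ 0 :=
    Finset.prod_ne_zero_iff.2 fun j _ => pow_ne_zero _ (hqi _).ne'
  have h4 : (q 0 : ℝ) ^ q 0 ≠ 0 := pow_ne_zero _ (hqi 0).ne'
  have h5 : (q 0 : ℝ) ^ (∑ j : Fin n, q j.succ) ≠ 0 := pow_ne_zero _ (hqi 0).ne'
  rw [h2]
  push_cast
  field_simp
  constructor <;> intro h <;> linarith

end IsWeights

end Modulus

/-! ### Extreme opposition and the zero set in projective space. -/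

section Opposition

variable {n : ℕ} {α : Fin (n + 1) → Fin n → ℤ} {y : Fin n → ℤ} {q : Fin (n + 1) → ℕ}
  {b : Fin (n + 1) → ℂ} {c : ℂ}

theorem BinomialRel.norm_eq (h : BinomialRel q b c) :
    ((∑ i, q i : ℕ) : ℝ) ^ (∑ i, q i) * ∏ i, ‖b i‖ ^ q i =
      (∏ i, (q i : ℝ) ^ q i) * ‖c‖ ^ ∑ i, q i := by
  unfold BinomialRel at h
  have := congrArg norm h
  simpa only [norm_mul, norm_pow, norm_prod, Complex.norm_natCast, norm_neg, norm_one, one_pow,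
    one_mul] using this

theorem extremeOpposition_of_isSingularZero (hq : IsWeights α y q) (hb : ∀ i, b i ≠ 0)
    {z : Fin n → ℂ} (h : IsSingularZero α y q b c z) : ExtremeOpposition α y b c := by
  refine ⟨z, h.1, fun i => ?_⟩
  have hbm : b i * monom (α i) z ≠ 0 := mul_ne_zero (hb i) (monom_ne_zero _ h.1)
  have hqi : (0 : ℝ) < q i := by exact_mod_cast hq.pos i
  have hqi' : (q i : ℂ) ≠ 0 := by exact_mod_cast (hq.pos i).ne'
  rw [← Complex.arg_neg_coe_angle hbm]
  have e : c * monom y z = ((∑ j, (q j : ℝ)) / q i : ℝ) * -(b i * monom (α i) z) := by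
    have := h.2 i
    push_cast
    field_simp
    linear_combination this
  rw [e, Complex.arg_real_mul _ (div_pos (sum_pos_of_pos hq.pos) hqi)]

/-- The point given by opposition need not be a singular zero: its terms have arbitrary positive
ratios `s i` in place of `q i / p`. The relation involves them only through `∏ s i ^ q i`, and the
modulus equation fixes this product. -/
theorem binomialRel_of_extremeOpposition (hq : IsWeights α y q) (hb : ∀ i, b i ≠ 0) (hc : c ≠ 0)
    (h : ExtremeOpposition α y b c)
    (hnorm : ((∑ i, q i : ℕ) : ℝ) ^ (∑ i, q i) * ∏ i, ‖b i‖ ^ q i =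
      (∏ i, (q i : ℝ) ^ q i) * ‖c‖ ^ ∑ i, q i) : BinomialRel q b c := by
  obtain ⟨z, hz, h⟩ := h
  have hs : ∀ i, ∃ s : ℝ, 0 < s ∧ -(b i * monom (α i) z) = s * (c * monom y z) := by
    intro i
    have hbm : b i * monom (α i) z ≠ 0 := mul_ne_zero (hb i) (monom_ne_zero _ hz)
    have hcm : c * monom y z ≠ 0 := mul_ne_zero hc (monom_ne_zero _ hz)
    have h1 := h i
    rw [← Complex.arg_neg_coe_angle hbm, Complex.arg_coe_angle_eq_iff,
      Complex.arg_eq_arg_iff hcm (neg_ne_zero.2 hbm)] at h1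
    refine ⟨‖-(b i * monom (α i) z)‖ / ‖c * monom y z‖,
      div_pos (norm_pos_iff.2 (neg_ne_zero.2 hbm)) (norm_pos_iff.2 hcm), ?_⟩
    rw [Complex.ofReal_div]
    exact h1.symm
  choose s hs0 hs using hs
  have h2 : ∏ i, ((-1) * (b i * monom (α i) z)) ^ q i =
      ∏ i, ((s i : ℂ) * (c * monom y z)) ^ q i :=
    Finset.prod_congr rfl fun i _ => by rw [← hs i]; ring
  simp only [mul_pow, Finset.prod_mul_distrib, Finset.prod_pow_eq_pow_sum,
    hq.prod_monom_pow hz] at h2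
  have hm : monom y z ^ (∑ i, q i) ≠ 0 := pow_ne_zero _ (monom_ne_zero _ hz)
  have h3 : (-1) ^ (∑ i, q i) * ∏ i, b i ^ q i = (∏ i, (s i : ℂ) ^ q i) * c ^ ∑ i, q i :=
    mul_right_cancel₀ hm (by linear_combination h2)
  have h4 : ∏ i, ‖b i‖ ^ q i = (∏ i, s i ^ q i) * ‖c‖ ^ ∑ i, q i := by
    have := congrArg norm h3
    simpa only [norm_mul, norm_pow, norm_prod, norm_neg, norm_one, one_pow, one_mul,
      Complex.norm_real, Real.norm_of_nonneg (hs0 _).le] using this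
  have h5 : ((∑ i, q i : ℕ) : ℝ) ^ (∑ i, q i) * (∏ i, s i ^ q i) = ∏ i, (q i : ℝ) ^ q i := by
    refine mul_right_cancel₀ (pow_ne_zero (∑ i, q i) (norm_ne_zero_iff.2 hc)) ?_
    rw [← hnorm, h4]; ring
  have h6 := congrArg (Complex.ofReal) h5
  push_cast at h6
  have h7 : ((-1 : ℂ) ^ (∑ i, q i)) * (-1) ^ (∑ i, q i) = 1 := by
    rw [← mul_pow]; norm_num
  unfold BinomialRel
  push_cast
  linear_combination (-1) ^ (∑ i, q i) * (∑ i, (q i : ℂ)) ^ (∑ i, q i) * h3 +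
    (-1) ^ (∑ i, q i) * c ^ (∑ i, q i) * h6 -
    (∑ i, (q i : ℂ)) ^ (∑ i, q i) * (∏ i, b i ^ q i) * h7

theorem torusVariety_eq (hq : IsWeights α y q) {Δ : MvPolynomial (Option (Fin (n + 1))) ℤ}
    (hΔ : ∀ v : Option (Fin (n + 1)) → ℂ, MvPolynomial.aeval v Δ = 0 ↔
      BinomialRel q (fun i => v (some i)) (v none)) :
    torusVariety Δ =
      {p | ∃ (b : Fin (n + 1) → ℂ) (c : ℂ) (hb0 : b 0 = 1),
        (∀ i, b i ≠ 0) ∧ c ≠ 0 ∧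
        p = Projectivization.mk ℂ (coeffs b c) (coeffs_ne_zero hb0 c) ∧
        ExtremeOpposition α y b c ∧ SwitchesLastAt α y b c ‖c‖ ∧
        ‖c‖ = ‖thetaHat α y b‖ *
          (1 + ∑ j, detCol (matMhat α y) y j / (matMhat α y).det)} := by
  ext P
  constructor
  · intro hP
    obtain ⟨hv, h0⟩ := hP P.rep P.rep_nonzero P.mk_rep
    set v := P.rep with hvdef
    -- Both sides of the relation are homogeneous of degree `p`, so the representative may be scaled
    -- to `b 0 = 1`.
    set a := (v (some 0))⁻¹ with ha
    have ha0 : a ≠ 0 := inv_ne_zero (hv _)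
    have hrel := ((hΔ v).1 h0).smul a
    have hb : ∀ i, a * v (some i) ≠ 0 := fun i => mul_ne_zero ha0 (hv _)
    have hc : a * v none ≠ 0 := mul_ne_zero ha0 (hv _)
    have hb0 : a * v (some 0) = 1 := inv_mul_cancel₀ (hv _)
    obtain ⟨z, hz⟩ := (hq.exists_isSingularZero_iff hb hc).2 hrel
    refine ⟨fun i => a * v (some i), a * v none, hb0, hb, hc, ?_,
      extremeOpposition_of_isSingularZero hq hb hz,
      switchesLastAt_of_isSingularZero hc hq.pos hq.rel hz, (hq.norm_eq_iff hb0 _).2 hrel.norm_eq⟩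
    rw [← P.mk_rep, Projectivization.mk_eq_mk_iff']
    refine ⟨a⁻¹, funext fun i => ?_⟩
    cases i <;> exact inv_mul_cancel_left₀ ha0 _
  · rintro ⟨b, c, hb0, hb, hc, rfl, hopp, -, hnorm⟩ v hv hvP
    have hrel := binomialRel_of_extremeOpposition hq hb hc hopp ((hq.norm_eq_iff hb0 c).1 hnorm)
    rw [Projectivization.mk_eq_mk_iff'] at hvP
    obtain ⟨a, rfl⟩ := hvP
    have ha0 : a ≠ 0 := by rintro rfl; simp at hv
    refine ⟨fun i => mul_ne_zero ha0 ?_, (hΔ _).2 (hrel.smul a)⟩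
    cases i with
    | none => exact hc
    | some i => exact hb i

end Opposition

end AmoebaDisc

theorem mainTheorem10 (n : ℕ) (hn : 0 < n) (α : Fin (n + 1) → Fin n → ℤ) (y : Fin n → ℤ)
    (hα0 : α 0 = 0)
    (hsimplex : AffineIndependent ℝ fun (i : Fin (n + 1)) (k : Fin n) => (α i k : ℝ))
    (hy : (fun k => (y k : ℝ)) ∈ interior (convexHull ℝ
      (Set.range fun (i : Fin (n + 1)) (k : Fin n) => (α i k : ℝ)))) :
    (∃ Δ : MvPolynomial (Option (Fin (n + 1))) ℤ,
      AmoebaDisc.IsADiscriminant (AmoebaDisc.exponents α y) Δ) ∧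
    ∀ Δ : MvPolynomial (Option (Fin (n + 1))) ℤ,
      AmoebaDisc.IsADiscriminant (AmoebaDisc.exponents α y) Δ →
        AmoebaDisc.IsBinomial Δ ∧
        AmoebaDisc.torusVariety Δ =
          {p | ∃ (b : Fin (n + 1) → ℂ) (c : ℂ) (hb0 : b 0 = 1),
            (∀ i, b i ≠ 0) ∧ c ≠ 0 ∧
            p = Projectivization.mk ℂ (AmoebaDisc.coeffs b c)
              (AmoebaDisc.coeffs_ne_zero hb0 c) ∧
            AmoebaDisc.ExtremeOpposition α y b c ∧
            AmoebaDisc.SwitchesLastAt α y b c ‖c‖ ∧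
            ‖c‖ = ‖AmoebaDisc.thetaHat α y b‖ *
              (1 + ∑ j, AmoebaDisc.detCol (AmoebaDisc.matMhat α y) y j /
                (AmoebaDisc.matMhat α y).det)} := by
  obtain ⟨q, hq⟩ := AmoebaDisc.exists_isWeights hα0 hsimplex hy
  obtain ⟨e₁, e₂, he⟩ := hq.exists_isRelCoeffs
  refine ⟨⟨_, hq.isADiscriminant_binomial he⟩, fun Δ hΔ => ?_⟩
  have hassoc := hq.associated_of_isADiscriminant he hΔ
  refine ⟨AmoebaDisc.isBinomial_of_associated hassoc (hq.support_binomial_card he),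
    AmoebaDisc.torusVariety_eq hq fun v => ?_⟩
  rw [AmoebaDisc.aeval_eq_zero_iff_of_associated hassoc, he.aeval_eq_zero_iff]
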